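/- Let $\mathcal M$ be a compact connected smooth manifold with non-empty boundary $\mathcal N$, where $\mathcal N$ is the total space of a smooth locally trivial fibration $\wp:\mathcal N\to\mathcal Y$ with compact fibers (base and fibers need not be connected, and their dimensions may vary from component to component of $\mathcal Y$). Let $$\mathcal R=\{f\in C^\infty(\mathcal M;\mathbb C): f|_{\mathcal N}\text{ is constant on the fibers of }\wp\}.$$ Let $x$ be a smooth defining function for $\mathcal N$, positive in the interior $\mathring{\mathcal M}$ (with $x=0$ and $dx\neq0$ on $\mathcal N$), let $\mathfrak m_b=x^{-1}\mathfrak m$ with a smooth positive density $\mathfrak m$ on $\mathcal M$, let $E,F\to\mathcal M$ be smooth complex vector bundles with smooth Hermitian metrics, and let $\gamma\in\mathbb R$. Write $x^{-\gamma}L^2_b(\mathcal M;E)$ for the $L^2$ space of sections of $E$ (modulo equality almost everywhere) with respect to $x^{2\gamma}\mathfrak m_b$, and similarly for $F$. An edge vector field is a smooth vector field on $\mathcal M$ which over $\mathcal N$ is tangent to the fibers of $\wp$. A first-order wedge operator is an operator $A=x^{-1}P$, where $P:C^\infty(\mathcal M;E)\to C^\infty(\mathcal M;F)$ is a first-order edge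 operator: locally, in trivializations of $E$ and $F$, $P$ is a matrix of operators of the form (edge vector fields) $+$ (functions), with smooth complex coefficients. It is $w$-elliptic if, writing locally $P=\sum_{j=0}^{n}B_jX_j+C$ with a local frame $X_0,\dots,X_n$ of the edge vector fields ($n+1=\dim\mathcal M$), the matrix $\sum_j\xi_jB_j(p)$ is invertible for every $p\in\mathcal M$ (including boundary points) and every $\xi\in\mathbb R^{n+1}\setminus0$. Let $$\mathcal D_{\max}(A)=\{u\in x^{-\gamma}L^2_b(\mathcal M;E): Au\in x^{-\gamma}L^2_b(\mathcal M;F)\},$$ with $Au$ taken in the sense of distributions in $\mathring{\mathcal M}$, and let $\mathcal D_{\min}(A)$ be the closure of $C_c^\infty(\mathring{\mathcal M};E)$ in $\mathcal D_{\max}(A)$ with respect to the graph norm $(\|Au\|^2+\|u\|^2)^{1/2}$ of $x^{-\gamma}L^2_b$. **Lemma.** If $A$ is a $w$-elliptic first-order wedge operator, then $\mathcal D_{\min}(A)$ and $\mathcal D_{\max}(A)$, hence also $\mathcal D_{\max}(A)/\mathcal D_{\min}(A)$, are modules over $\mathcal R$ (under pointwise multiplication). -/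

import Mathlib

open Set MeasureTheory Manifold Bundle
open scoped ContDiff Topology ENNReal

noncomputable section

namespace Wedge

universe u

/-! ### The boundary fibration

`M` is a manifold with boundary of dimension `n + 1`. Its boundary is the total space of a locally
trivial fibration with compact fibers. The base and the fibers need not be connected, and the
dimension of the base may depend on the component, so the fibration is given as a finite family
`φ i : N i → Y i` of fibrations of closed `n`-manifolds over manifolds of dimension `q i`, the
boundary of `M` being the disjoint union of the `N i`. -/

section Fibration

variable {n : ℕ} {M : Type*} [TopologicalSpace M] [ChartedSpace (EuclideanHalfSpace (n + 1)) M]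
  [IsManifold (𝓡∂ (n + 1)) ∞ M]
  {ι : Type*} {N : ι → Type u} [∀ i, TopologicalSpace (N i)]
  [∀ i, ChartedSpace (EuclideanSpace ℝ (Fin n)) (N i)]
  (q : ι → ℕ) {Y : ι → Type*} [∀ i, TopologicalSpace (Y i)]
  [∀ i, ChartedSpace (EuclideanSpace ℝ (Fin (q i))) (Y i)]

/-- The smooth map `φ` from a closed manifold onto `B` is a locally trivial fibration with compact
fibers: over a neighbourhood `V` of each point, it is diffeomorphic to the projection
`V × Z → V` for some compact manifold `Z`. -/
def IsSmoothFibration {n k : ℕ} {P : Type u} [TopologicalSpace P]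
    [ChartedSpace (EuclideanSpace ℝ (Fin n)) P] {B : Type*} [TopologicalSpace B]
    [ChartedSpace (EuclideanSpace ℝ (Fin k)) B] (φ : P → B) : Prop :=
  ContMDiff (𝓡 n) (𝓡 k) ∞ φ ∧ Function.Surjective φ ∧
  ∀ b : B, ∃ (V : Set B) (r : ℕ) (Z : Type u) (_ : TopologicalSpace Z)
    (_ : ChartedSpace (EuclideanSpace ℝ (Fin r)) Z),
    IsOpen V ∧ b ∈ V ∧ CompactSpace Z ∧ T2Space Z ∧ IsManifold (𝓡 r) ∞ Z ∧
    ∃ Φ : OpenPartialHomeomorph P (B × Z),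
      Φ.source = φ ⁻¹' V ∧ Φ.target = V ×ˢ univ ∧
      (∀ p ∈ Φ.source, (Φ p).1 = φ p) ∧
      ContMDiffOn (𝓡 n) ((𝓡 k).prod (𝓡 r)) ∞ Φ Φ.source ∧
      ContMDiffOn ((𝓡 k).prod (𝓡 r)) (𝓡 n) ∞ Φ.symm Φ.target

/-- The manifolds `N i`, embedded in `M` by `emb i`, together make up the boundary of `M`, and
`φ i : N i → Y i` are locally trivial fibrations. -/
structure IsBoundaryFibration (emb : ∀ i, N i → M) (φ : ∀ i, N i → Y i) : Prop where
  contMDiff_emb : ∀ i, ContMDiff (𝓡 n) (𝓡∂ (n + 1)) ∞ (emb i)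
  isEmbedding_emb : ∀ i, Topology.IsEmbedding (emb i)
  injective_mfderiv_emb : ∀ i p, Function.Injective (mfderiv (𝓡 n) (𝓡∂ (n + 1)) (emb i) p)
  disjoint_range : Pairwise fun i j => Disjoint (range (emb i)) (range (emb j))
  iUnion_range : ⋃ i, range (emb i) = (𝓡∂ (n + 1)).boundary M
  isSmoothFibration : ∀ i, IsSmoothFibration (n := n) (k := q i) (φ i)

/-- The ring of smooth complex-valued functions on `M` whose restriction to the boundary is
constant on the fibers of the boundary fibration. -/
def ringR (emb : ∀ i, N i → M) (φ : ∀ i, N i → Y i) : Subalgebra ℂ (M → ℂ) where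
  carrier := {f | ContMDiff (𝓡∂ (n + 1)) 𝓘(ℝ, ℂ) ∞ f ∧
    ∀ i (a b : N i), φ i a = φ i b → f (emb i a) = f (emb i b)}
  mul_mem' := by
    rintro f g ⟨hf, hf'⟩ ⟨hg, hg'⟩
    refine ⟨(contDiff_mul (𝕜 := ℝ) (𝔸 := ℂ)).comp_contMDiff (hf.prodMk_space hg), fun i a b h => ?_⟩
    simp only [Pi.mul_apply, hf' i a b h, hg' i a b h]
  add_mem' := by
    rintro f g ⟨hf, hf'⟩ ⟨hg, hg'⟩
    refine ⟨hf.add hg, fun i a b h => ?_⟩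
    simp only [Pi.add_apply, hf' i a b h, hg' i a b h]
  algebraMap_mem' c := ⟨contMDiff_const, fun _ _ _ _ => rfl⟩

/-- `x` is a smooth defining function for the boundary of `M`, positive in the interior. -/
structure IsDefiningFunction (x : M → ℝ) : Prop where
  contMDiff : ContMDiff (𝓡∂ (n + 1)) 𝓘(ℝ, ℝ) ∞ x
  pos : ∀ p ∈ (𝓡∂ (n + 1)).interior M, 0 < x p
  eq_zero : ∀ p ∈ (𝓡∂ (n + 1)).boundary M, x p = 0
  mfderiv_ne_zero : ∀ p ∈ (𝓡∂ (n + 1)).boundary M, mfderiv (𝓡∂ (n + 1)) 𝓘(ℝ, ℝ) x p ≠ 0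

/-- A smooth vector field on `M` is an edge vector field if over the boundary it is tangent to the
fibers of the boundary fibration. -/
def IsEdgeField (emb : ∀ i, N i → M) (φ : ∀ i, N i → Y i)
    (X : ∀ p : M, TangentSpace (𝓡∂ (n + 1)) p) : Prop :=
  ContMDiff (𝓡∂ (n + 1)) (𝓡∂ (n + 1)).tangent ∞
    (fun p => (⟨p, X p⟩ : TangentBundle (𝓡∂ (n + 1)) M)) ∧
  ∀ i (a : N i), ∃ τ : TangentSpace (𝓡 n) a,
    mfderiv (𝓡 n) (𝓡 (q i)) (φ i) a τ = 0 ∧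
    mfderiv (𝓡 n) (𝓡∂ (n + 1)) (emb i) a τ = X (emb i a)

/-- `X 0, …, X n` is a frame over `U` of the edge tangent bundle, i.e. a family of `n + 1` edge
vector fields which generates the edge vector fields over `U` with smooth coefficients. (The
coefficients are unique: over the interior `n + 1` vectors spanning the tangent space are
independent, and the interior is dense.) In adapted coordinates `x, y, z` an example is
`x ∂_x, x ∂_{y_j}, ∂_{z_μ}`. -/
def IsEdgeFrame (emb : ∀ i, N i → M) (φ : ∀ i, N i → Y i) (U : Set M)
    (X : Fin (n + 1) → ∀ p : M, TangentSpace (𝓡∂ (n + 1)) p) : Prop :=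
  (∀ j, IsEdgeField q emb φ (X j)) ∧
  ∀ W : (∀ p : M, TangentSpace (𝓡∂ (n + 1)) p), IsEdgeField q emb φ W →
    ∃ c : Fin (n + 1) → M → ℝ, (∀ j, ContMDiffOn (𝓡∂ (n + 1)) 𝓘(ℝ, ℝ) ∞ (c j) U) ∧
      ∀ p ∈ U, W p = ∑ j, c j p • X j p

/-- `μ` is (the measure of) a smooth positive density on `M`: in the chart around each point it has
a smooth positive density, up to the boundary, with respect to Lebesgue measure. -/
def IsSmoothDensity [MeasurableSpace M] (μ : Measure M) : Prop :=
  ∀ p₀ : M, ∃ ρ : EuclideanSpace ℝ (Fin (n + 1)) → ℝ,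
    ContDiffOn ℝ ∞ ρ (extChartAt (𝓡∂ (n + 1)) p₀).target ∧
    (∀ v ∈ (extChartAt (𝓡∂ (n + 1)) p₀).target, 0 < ρ v) ∧
    ∀ S : Set M, MeasurableSet S → S ⊆ (extChartAt (𝓡∂ (n + 1)) p₀).source →
      μ S = ∫⁻ v in extChartAt (𝓡∂ (n + 1)) p₀ '' S, ENNReal.ofReal (ρ v)

/-- `mb` is (the measure of) a smooth positive b-density: `mb = x⁻¹ μ` with a smooth positive
density `μ`. In particular the boundary is a null set for `mb`. -/
def IsBDensity [MeasurableSpace M] (x : M → ℝ) (mb : Measure M) : Prop :=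
  ∃ μ : Measure M, IsSmoothDensity (n := n) μ ∧
    mb = μ.withDensity fun p => ENNReal.ofReal (x p)⁻¹

end Fibration

/-! ### Sections of Hermitian vector bundles -/

section Sections

variable (n : ℕ) {M : Type*} [TopologicalSpace M] [ChartedSpace (EuclideanHalfSpace (n + 1)) M]
  [IsManifold (𝓡∂ (n + 1)) ∞ M]
  (F : Type*) [NormedAddCommGroup F] [NormedSpace ℂ F]
  (E : M → Type*) [TopologicalSpace (TotalSpace F E)] [∀ p, NormedAddCommGroup (E p)]
  [∀ p, InnerProductSpace ℂ (E p)] [FiberBundle F E] [VectorBundle ℂ F E]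

/-- The Hermitian inner product in the fibers of `E` depends smoothly on the base point. -/
def IsSmoothHermitian : Prop :=
  ∀ (p₀ : M) (a b : F), ContMDiffOn (𝓡∂ (n + 1)) 𝓘(ℝ, ℂ) ∞
    (fun p => inner ℂ ((trivializationAt F E p₀).symm p a) ((trivializationAt F E p₀).symm p b))
    (trivializationAt F E p₀).baseSet

variable {E} in
/-- The section `s` in the trivialization around `p₀`. -/
def localRep (p₀ : M) (s : ∀ p, E p) (p : M) : F :=
  (trivializationAt F E p₀ ⟨p, s p⟩).2

/-- The space of smooth sections of `E` over `M`. -/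
def smoothSections [VectorBundle ℝ F E] [ContMDiffVectorBundle ∞ F E (𝓡∂ (n + 1))] :
    Submodule ℂ (∀ p, E p) where
  carrier := {s | ContMDiff (𝓡∂ (n + 1)) ((𝓡∂ (n + 1)).prod 𝓘(ℝ, F)) ∞
    fun p => (⟨p, s p⟩ : TotalSpace F E)}
  add_mem' hs ht := hs.add_section ht
  zero_mem' := contMDiff_zeroSection ℝ E
  smul_mem' c s hs := by
    intro p₀
    have h := (contMDiffAt_section p₀).1 (hs p₀)
    refine (contMDiffAt_section p₀).2 ?_
    have h2 : ContMDiffAt (𝓡∂ (n + 1)) 𝓘(ℝ, F) ∞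
        (fun p => c • (trivializationAt F E p₀ ⟨p, s p⟩).2) p₀ := by
      exact ((c • ContinuousLinearMap.id ℝ F).contMDiff.contMDiffAt).comp p₀ h
    refine h2.congr_of_eventuallyEq ?_
    filter_upwards [(trivializationAt F E p₀).open_baseSet.mem_nhds
      (FiberBundle.mem_baseSet_trivializationAt' p₀)] with p hp
    exact ((trivializationAt F E p₀).linear ℂ hp).map_smul c (s p)

variable {F E} in
/-- The section `s` vanishes near the boundary. For a smooth section `s` over a compact `M` this
says that `s` is a smooth section with compact support in the interior. -/
def SupportedInInterior (s : ∀ p, E p) : Prop :=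
  closure {p | s p ≠ 0} ⊆ (𝓡∂ (n + 1)).interior M

/-- Sections that vanish almost everywhere. -/
def nullSections [MeasurableSpace M] (mb : Measure M) : Submodule (M → ℂ) (∀ p, E p) where
  carrier := {s | ∀ᵐ p ∂mb, s p = 0}
  add_mem' := by
    intro s t hs ht
    simp only [mem_ofPred_eq] at *
    filter_upwards [hs, ht] with p h1 h2
    simp [h1, h2]
  zero_mem' := by simp
  smul_mem' := by
    intro f s hs
    simp only [mem_ofPred_eq] at *
    filter_upwards [hs] with p h
    change f p • s p = 0
    rw [h, smul_zero]

/-- Sections of `E` modulo equality almost everywhere. It is a module over the functions on `M`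
by pointwise multiplication. -/
abbrev SectionClass [MeasurableSpace M] (mb : Measure M) : Type _ :=
  (∀ p, E p) ⧸ nullSections E mb

variable {E} in
/-- The squared norm in `x^{-γ} L²_b`, i.e. in the `L²` space of sections with respect to
`x^{2γ} mb`. -/
def normSq [MeasurableSpace M] (x : M → ℝ) (mb : Measure M) (γ : ℝ) (s : ∀ p, E p) : ℝ≥0∞ :=
  ∫⁻ p, ENNReal.ofReal (‖s p‖ ^ 2 * x p ^ (2 * γ)) ∂mb

variable {E} in
/-- The inner product of `x^{-γ} L²_b`, linear in the first argument. -/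
def pairing [MeasurableSpace M] (x : M → ℝ) (mb : Measure M) (γ : ℝ) (s t : ∀ p, E p) : ℂ :=
  ∫ p, inner ℂ (t p) (s p) * ((x p ^ (2 * γ) : ℝ) : ℂ) ∂mb

variable {E} in
/-- `s` is a (measurable) section of class `x^{-γ} L²_b`. -/
def IsL2 [MeasurableSpace M] (x : M → ℝ) (mb : Measure M) (γ : ℝ) (s : ∀ p, E p) : Prop :=
  (∀ p₀ : M, AEStronglyMeasurable (localRep F p₀ s)
    (mb.restrict (trivializationAt F E p₀).baseSet)) ∧
  normSq x mb γ s < ⊤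

end Sections

/-! ### First order edge and wedge operators -/

section Operators

variable {n : ℕ} {M : Type*} [TopologicalSpace M] [ChartedSpace (EuclideanHalfSpace (n + 1)) M]
  [IsManifold (𝓡∂ (n + 1)) ∞ M]
  {ι : Type*} {N : ι → Type u} [∀ i, TopologicalSpace (N i)]
  [∀ i, ChartedSpace (EuclideanSpace ℝ (Fin n)) (N i)]
  (q : ι → ℕ) {Y : ι → Type*} [∀ i, TopologicalSpace (Y i)]
  [∀ i, ChartedSpace (EuclideanSpace ℝ (Fin (q i))) (Y i)]
  {FE : Type*} [NormedAddCommGroup FE] [NormedSpace ℂ FE]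
  {E : M → Type*} [TopologicalSpace (TotalSpace FE E)] [∀ p, NormedAddCommGroup (E p)]
  [∀ p, InnerProductSpace ℂ (E p)] [FiberBundle FE E] [VectorBundle ℂ FE E]
  [VectorBundle ℝ FE E] [ContMDiffVectorBundle ∞ FE E (𝓡∂ (n + 1))]
  {FF : Type*} [NormedAddCommGroup FF] [NormedSpace ℂ FF]
  {F : M → Type*} [TopologicalSpace (TotalSpace FF F)] [∀ p, NormedAddCommGroup (F p)]
  [∀ p, InnerProductSpace ℂ (F p)] [FiberBundle FF F] [VectorBundle ℂ FF F]
  [VectorBundle ℝ FF F] [ContMDiffVectorBundle ∞ FF F (𝓡∂ (n + 1))]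

/-- In the trivializations of `E` and `F` around `p₀`, the operator `P` is given over `U` by
`∑ j, B j · X j + C`, where the `X j` are vector fields, acting by differentiation, and `B j`, `C`
are smooth matrices. -/
def HasLocalForm (P : smoothSections n FE E →ₗ[ℂ] smoothSections n FF F) (p₀ : M) (U : Set M)
    {κ : Type} [Fintype κ] (X : κ → ∀ p : M, TangentSpace (𝓡∂ (n + 1)) p)
    (B : κ → M → FE →L[ℂ] FF) (C : M → FE →L[ℂ] FF) : Prop :=
  (∀ j, ContMDiffOn (𝓡∂ (n + 1)) 𝓘(ℝ, FE →L[ℂ] FF) ∞ (B j) U) ∧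
  ContMDiffOn (𝓡∂ (n + 1)) 𝓘(ℝ, FE →L[ℂ] FF) ∞ C U ∧
  ∀ s : smoothSections n FE E, ∀ p ∈ U,
    localRep FF p₀ (P s : ∀ p, F p) p =
      ∑ j, B j p (mfderiv (𝓡∂ (n + 1)) 𝓘(ℝ, FE) (localRep FE p₀ (s : ∀ p, E p)) p (X j p) : FE)
        + C p (localRep FE p₀ (s : ∀ p, E p) p)

/-- `P` is an edge differential operator of order (at most) one: near each point it is given in
trivializations by a matrix whose entries are combinations, with smooth coefficients, of edge vector
fields and the identity. -/
def IsEdgeOperator (emb : ∀ i, N i → M) (φ : ∀ i, N i → Y i)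
    (P : smoothSections n FE E →ₗ[ℂ] smoothSections n FF F) : Prop :=
  ∀ p₀ : M, ∃ U : Set M, IsOpen U ∧ p₀ ∈ U ∧
    U ⊆ (trivializationAt FE E p₀).baseSet ∩ (trivializationAt FF F p₀).baseSet ∧
    ∃ (k : ℕ) (X : Fin k → ∀ p : M, TangentSpace (𝓡∂ (n + 1)) p)
      (B : Fin k → M → FE →L[ℂ] FF) (C : M → FE →L[ℂ] FF),
      (∀ j, IsEdgeField q emb φ (X j)) ∧ HasLocalForm P p₀ U X B C

/-- `A = x⁻¹ P` in the interior. (At boundary points, which form a null set, `A s` has the value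
`0`.) -/
def EqInvMul (x : M → ℝ) (A : smoothSections n FE E →ₗ[ℂ] (∀ p, F p))
    (P : smoothSections n FE E →ₗ[ℂ] smoothSections n FF F) : Prop :=
  ∀ s p, A s p = ((x p : ℂ)⁻¹) • (P s : ∀ p, F p) p

/-- `A` is a wedge differential operator of order one, `A = x⁻¹ P` with an edge differential
operator `P` of order one. -/
def IsWedgeOperator (emb : ∀ i, N i → M) (φ : ∀ i, N i → Y i) (x : M → ℝ)
    (A : smoothSections n FE E →ₗ[ℂ] (∀ p, F p)) : Prop :=
  ∃ P : smoothSections n FE E →ₗ[ℂ] smoothSections n FF F,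
    IsEdgeOperator q emb φ P ∧ EqInvMul x A P

/-- The wedge operator `A` is w-elliptic. Let `X j` be a local frame of the edge tangent bundle, so
that the `x⁻¹ X j` are a local frame of the w-tangent bundle. If
`A = ∑ j, B j · x⁻¹ X j + x⁻¹ C` then, up to a factor `i`, the principal w-symbol of `A` at the
w-covector over `p` with components `ξ j` in the dual frame is `∑ j, ξ j • B j p`. It has to be
invertible for all `p`, also on the boundary, and all `ξ ≠ 0`. -/
def IsWElliptic (emb : ∀ i, N i → M) (φ : ∀ i, N i → Y i) (x : M → ℝ)
    (A : smoothSections n FE E →ₗ[ℂ] (∀ p, F p)) : Prop :=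
  ∃ P : smoothSections n FE E →ₗ[ℂ] smoothSections n FF F, EqInvMul x A P ∧
    ∀ p₀ : M, ∃ U : Set M, IsOpen U ∧ p₀ ∈ U ∧
      U ⊆ (trivializationAt FE E p₀).baseSet ∩ (trivializationAt FF F p₀).baseSet ∧
      ∃ (X : Fin (n + 1) → ∀ p : M, TangentSpace (𝓡∂ (n + 1)) p)
        (B : Fin (n + 1) → M → FE →L[ℂ] FF) (C : M → FE →L[ℂ] FF),
        IsEdgeFrame q emb φ U X ∧ HasLocalForm P p₀ U X B C ∧
        ∀ ξ : Fin (n + 1) → ℝ, ξ ≠ 0 →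
          Function.Bijective fun v : FE => ∑ j, ((ξ j : ℝ) : ℂ) • B j p₀ v

variable [MeasurableSpace M] (x : M → ℝ) (mb : Measure M) (γ : ℝ)
  (A : smoothSections n FE E →ₗ[ℂ] (∀ p, F p))

/-- `t'` is the image of the test section `t` of `F` under the formal adjoint of `A` with respect
to `x^{-γ} L²_b`: `(A s, t) = (s, t')` for all smooth sections `s` of `E` with compact support in
the interior. -/
def IsFormalAdjointImage (t : smoothSections n FF F) (t' : smoothSections n FE E) : Prop :=
  ∀ s : smoothSections n FE E, SupportedInInterior n (s : ∀ p, E p) →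
    pairing x mb γ (A s) (t : ∀ p, F p) = pairing x mb γ (s : ∀ p, E p) (t' : ∀ p, E p)

variable (FF) in
/-- `A u = w` in the sense of distributions in the interior: `(w, t) = (u, A⋆ t)` for all smooth
sections `t` of `F` with compact support in the interior, `A⋆` being the formal adjoint. -/
def IsWeakImage (u : ∀ p, E p) (w : ∀ p, F p) : Prop :=
  ∀ (t : smoothSections n FF F) (t' : smoothSections n FE E),
    SupportedInInterior n (t : ∀ p, F p) → SupportedInInterior n (t' : ∀ p, E p) →
    IsFormalAdjointImage x mb γ A t t' →
    pairing x mb γ w (t : ∀ p, F p) = pairing x mb γ u (t' : ∀ p, E p)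

variable (FF) in
/-- The maximal domain: all `u` in `x^{-γ} L²_b` with `A u` in `x^{-γ} L²_b`. -/
def maxDomain : Set (SectionClass E mb) :=
  Submodule.Quotient.mk '' {u : ∀ p, E p | IsL2 FE x mb γ u ∧
    ∃ w : ∀ p, F p, IsL2 FF x mb γ w ∧ IsWeakImage FF x mb γ A u w}

variable (FF) in
/-- The minimal domain: the closure, in the maximal domain with the graph norm
`(‖A u‖² + ‖u‖²)^(1/2)`, of the smooth sections with compact support in the interior. -/
def minDomain : Set (SectionClass E mb) :=
  Submodule.Quotient.mk '' {u : ∀ p, E p | IsL2 FE x mb γ u ∧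
    ∃ w : ∀ p, F p, IsL2 FF x mb γ w ∧ IsWeakImage FF x mb γ A u w ∧
      ∀ ε : ℝ≥0∞, 0 < ε → ∃ s : smoothSections n FE E, SupportedInInterior n (s : ∀ p, E p) ∧
        normSq x mb γ (w - A s) + normSq x mb γ (u - (s : ∀ p, E p)) < ε}

end Operators

end Wedge

end

/-! Everything rests on one commutator. Write the edge operator locally as `P = ∑ B_j X_j + C` with
edge fields `X_j`. For smooth `f` the Leibniz rule gives `[P, f] = ∑ (X_j f) B_j`, a bundle
homomorphism `T` with smooth local matrices. If `f` is constant on the fibers over the boundary,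
then `X_j f` vanishes there, because `X_j` is tangent to those fibers. A smooth function that
vanishes on the boundary is `O(x)`, so `‖T‖ ≤ C x` (compactness makes the bound global) and `S = [A,
f] = x⁻¹ T` is a bounded homomorphism. Only boundedness and measurability of `S` are needed up to
the boundary, so no smooth division by `x` is carried out.

The identity `A (f u) = f A u + S u` passes to distributions by duality. In the interior the formal
adjoints satisfy `A⋆ (f̄ t) = f̄ A⋆ t - S⋆ t`, and `S⋆ t = T⋆ (x⁻¹ t)` is again a test section when
`t` is one. Since `f` and `S` act boundedly on `x^{-γ} L²_b`, the maximal domain is stable under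
`f`. If test sections `s` converge to `u` in the graph norm, then `f s` converges to `f u`, since `A
(f s) = f A s + S s`; so the minimal domain is stable too.

The analytic core is `exists_norm_le_mul_definingFunction`, `dirDeriv_eq_zero_of_mem_boundary` and
`exists_commutator`, packaged in `exists_isTameCommutator`. The two stability statements are
`IsWeakImage.smul` and `IsGraphLimit.smul`. The Gram operator of the Hermitian metric transfers
smoothness, measurability and norm bounds between a bundle and its model fiber, and supplies
adjoints of homomorphisms. -/

set_option linter.unusedSectionVars false

noncomputable section

namespace Wedge

universe u

/-! ### Smooth sections in trivializations, and their products with functions. -/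

section SectionCalculus

variable {n : ℕ} {M : Type*} [TopologicalSpace M] [ChartedSpace (EuclideanHalfSpace (n + 1)) M]
  [IsManifold (𝓡∂ (n + 1)) ∞ M]
  {F : Type*} [NormedAddCommGroup F] [NormedSpace ℂ F]
  {E : M → Type*} [TopologicalSpace (TotalSpace F E)] [∀ p, NormedAddCommGroup (E p)]
  [∀ p, InnerProductSpace ℂ (E p)] [FiberBundle F E] [VectorBundle ℂ F E]

lemma contMDiffAt_complex_smul {f : M → ℂ} {g : M → F} {p : M}
    (hf : ContMDiffAt (𝓡∂ (n + 1)) 𝓘(ℝ, ℂ) ∞ f p) (hg : ContMDiffAt (𝓡∂ (n + 1)) 𝓘(ℝ, F) ∞ g p) :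
    ContMDiffAt (𝓡∂ (n + 1)) 𝓘(ℝ, F) ∞ (fun p => f p • g p) p :=
  (isBoundedBilinearMap_smul (𝕜 := ℝ) (A := ℂ) (E := F)).contDiff.contDiffAt.comp_contMDiffAt
    (hf.prodMk_space hg)

lemma localRep_add (p₀ : M) (s t : ∀ p, E p) {p : M} (hp : p ∈ (trivializationAt F E p₀).baseSet) :
    localRep F p₀ (s + t) p = localRep F p₀ s p + localRep F p₀ t p :=
  ((trivializationAt F E p₀).linear ℂ hp).map_add _ _

lemma localRep_smul (p₀ : M) (f : M → ℂ) (s : ∀ p, E p) {p : M}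
    (hp : p ∈ (trivializationAt F E p₀).baseSet) :
    localRep F p₀ (f • s) p = f p • localRep F p₀ s p :=
  ((trivializationAt F E p₀).linear ℂ hp).map_smul _ _

lemma symm_localRep (p₀ : M) (s : ∀ p, E p) {p : M}
    (hp : p ∈ (trivializationAt F E p₀).baseSet) :
    (trivializationAt F E p₀).symm p (localRep F p₀ s p) = s p :=
  (trivializationAt F E p₀).symm_apply_apply_mk hp _

variable [VectorBundle ℝ F E] [ContMDiffVectorBundle ∞ F E (𝓡∂ (n + 1))]

lemma contMDiffAt_section_iff_localRep {s : ∀ p, E p} {p₀ p : M}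
    (hp : p ∈ (trivializationAt F E p₀).baseSet) :
    ContMDiffAt (𝓡∂ (n + 1)) ((𝓡∂ (n + 1)).prod 𝓘(ℝ, F)) ∞
      (fun p => (⟨p, s p⟩ : TotalSpace F E)) p ↔
    ContMDiffAt (𝓡∂ (n + 1)) 𝓘(ℝ, F) ∞ (localRep F p₀ s) p :=
  (trivializationAt F E p₀).contMDiffAt_section_iff hp

lemma contMDiffOn_localRep {s : ∀ p, E p} (hs : s ∈ smoothSections n F E) (p₀ : M) :
    ContMDiffOn (𝓡∂ (n + 1)) 𝓘(ℝ, F) ∞ (localRep F p₀ s) (trivializationAt F E p₀).baseSet :=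
  fun p hp => ((contMDiffAt_section_iff_localRep hp).1 (hs p)).contMDiffWithinAt

lemma contMDiffAt_smul_section {s : ∀ p, E p} {f : M → ℂ} {p : M}
    (hf : ContMDiffAt (𝓡∂ (n + 1)) 𝓘(ℝ, ℂ) ∞ f p)
    (hs : ContMDiffAt (𝓡∂ (n + 1)) ((𝓡∂ (n + 1)).prod 𝓘(ℝ, F)) ∞
      (fun p => (⟨p, s p⟩ : TotalSpace F E)) p) :
    ContMDiffAt (𝓡∂ (n + 1)) ((𝓡∂ (n + 1)).prod 𝓘(ℝ, F)) ∞
      (fun p => (⟨p, (f • s) p⟩ : TotalSpace F E)) p := by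
  have hp := FiberBundle.mem_baseSet_trivializationAt' (F := F) (E := E) p
  rw [contMDiffAt_section_iff_localRep hp] at hs ⊢
  refine (contMDiffAt_complex_smul hf hs).congr_of_eventuallyEq ?_
  filter_upwards [(trivializationAt F E p).open_baseSet.mem_nhds hp] with y hy
  exact localRep_smul p f s hy

lemma smul_mem_smoothSections {s : ∀ p, E p} {f : M → ℂ}
    (hf : ContMDiff (𝓡∂ (n + 1)) 𝓘(ℝ, ℂ) ∞ f) (hs : s ∈ smoothSections n F E) :
    f • s ∈ smoothSections n F E :=
  fun p => contMDiffAt_smul_section (hf p) (hs p)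

/-- The complement of the support is an open neighbourhood of the boundary. This is what allows
multiplication by functions such as `x⁻¹` that are singular on the boundary. -/
lemma SupportedInInterior.eventually_eq_zero {s : ∀ p, E p} (hs : SupportedInInterior n s) {p : M}
    (hp : p ∈ (𝓡∂ (n + 1)).boundary M) : ∀ᶠ y in 𝓝 p, s y = 0 := by
  have h : (closure {p | s p ≠ 0})ᶜ ∈ 𝓝 p := by
    refine isClosed_closure.isOpen_compl.mem_nhds fun h => ?_
    exact (ModelWithCorners.disjoint_interior_boundary (I := 𝓡∂ (n + 1))).le_bot ⟨hs h, hp⟩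
  filter_upwards [h] with y hy
  by_contra h0
  exact hy (subset_closure h0)

lemma SupportedInInterior.of_imp {E' : M → Type*} [∀ p, NormedAddCommGroup (E' p)]
    {s : ∀ p, E p} {t : ∀ p, E' p}
    (hs : SupportedInInterior n s) (h : ∀ p, s p = 0 → t p = 0) : SupportedInInterior n t :=
  (closure_mono fun (p : M) (hp : t p ≠ 0) hp' => hp (h p hp')).trans hs

/-- A section supported in the interior may be multiplied by functions that are smooth only there. -/
lemma smul_mem_smoothSections_of_supportedInInterior {s : ∀ p, E p} {f : M → ℂ}
    (hf : ∀ p ∈ (𝓡∂ (n + 1)).interior M, ContMDiffAt (𝓡∂ (n + 1)) 𝓘(ℝ, ℂ) ∞ f p)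
    (hs : s ∈ smoothSections n F E) (hs' : SupportedInInterior n s) :
    f • s ∈ smoothSections n F E := by
  intro p
  rcases (𝓡∂ (n + 1)).isInteriorPoint_or_isBoundaryPoint p with hp | hp
  · exact contMDiffAt_smul_section (hf p hp) (hs p)
  · refine ((zero_mem (smoothSections n F E) : _) p).congr_of_eventuallyEq ?_
    filter_upwards [hs'.eventually_eq_zero hp] with y hy
    simp [hy]

/-- A bump function times the constant section of a trivialization. It lets a bundle homomorphism be
identified fiberwise from its action on smooth sections. -/
lemma exists_smoothSection_eq [T2Space M] (p : M) (v : E p) :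
    ∃ s : smoothSections n F E, (s : ∀ p, E p) p = v := by
  classical
  set e := trivializationAt F E p with he
  have hp : p ∈ e.baseSet := FiberBundle.mem_baseSet_trivializationAt' p
  obtain ⟨g, hg⟩ := (SmoothBumpFunction.nhds_basis_tsupport (I := 𝓡∂ (n + 1)) p).mem_iff.1
    (e.open_baseSet.mem_nhds hp)
  let s : ∀ y, E y := fun y => ((g y : ℝ) : ℂ) • e.symm y (e ⟨p, v⟩).2
  refine ⟨⟨s, fun y => ?_⟩, ?_⟩
  · by_cases hy : y ∈ tsupport g
    · have hyb := hg.2 hy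
      rw [contMDiffAt_section_iff_localRep (p₀ := p) hyb]
      have h1 : ContMDiffAt (𝓡∂ (n + 1)) 𝓘(ℝ, F) ∞ (fun y => (g y : ℝ) • (e ⟨p, v⟩).2) y :=
        g.contMDiffAt.smul contMDiffAt_const
      refine h1.congr_of_eventuallyEq ?_
      filter_upwards [e.open_baseSet.mem_nhds hyb] with z hz
      change (e ⟨z, ((g z : ℝ) : ℂ) • e.symm z (e ⟨p, v⟩).2⟩).2 = _
      rw [(e.linear ℂ hz).map_smul, e.apply_mk_symm hz]
      simp
    · refine ((zero_mem (smoothSections n F E) : _) y).congr_of_eventuallyEq ?_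
      filter_upwards [(isClosed_tsupport g).isOpen_compl.mem_nhds hy] with z hz
      simp [s, image_eq_zero_of_notMem_tsupport hz]
  · change ((g p : ℝ) : ℂ) • e.symm p (e ⟨p, v⟩).2 = v
    rw [g.eq_one, e.symm_apply_apply_mk hp]
    simp

end SectionCalculus

/-! ### The Hermitian metric in a trivialization. -/

section Gram

variable {n : ℕ} {M : Type*} [TopologicalSpace M] [ChartedSpace (EuclideanHalfSpace (n + 1)) M]
  [IsManifold (𝓡∂ (n + 1)) ∞ M]
  {F : Type*} [NormedAddCommGroup F] [NormedSpace ℂ F] [FiniteDimensional ℂ F]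
  {E : M → Type*} [TopologicalSpace (TotalSpace F E)] [∀ p, NormedAddCommGroup (E p)]
  [∀ p, InnerProductSpace ℂ (E p)] [FiberBundle F E] [VectorBundle ℂ F E]

variable (F E) in
/-- The Gram operator of the Hermitian metric in the trivialization around `p₀`, with respect to a
fixed basis of the model fiber. -/
def gram (p₀ p : M) : F →L[ℂ] F :=
  ∑ i, ∑ j, inner ℂ ((trivializationAt F E p₀).symm p (Module.finBasis ℂ F i))
      ((trivializationAt F E p₀).symm p (Module.finBasis ℂ F j)) •
    (LinearMap.toContinuousLinearMap ((Module.finBasis ℂ F).coord j)).smulRight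
      (Module.finBasis ℂ F i)

lemma symm_eq_sum {p₀ p : M} (hp : p ∈ (trivializationAt F E p₀).baseSet) (a : F) :
    (trivializationAt F E p₀).symm p a = ∑ j, (Module.finBasis ℂ F).repr a j •
      (trivializationAt F E p₀).symm p (Module.finBasis ℂ F j) := by
  rw [← (trivializationAt F E p₀).coe_symmₗ (R := ℂ) hp]
  simp only [← map_smul, ← map_sum, (Module.finBasis ℂ F).sum_repr]

lemma gram_apply {p₀ p : M} (hp : p ∈ (trivializationAt F E p₀).baseSet) (a : F) :
    gram F E p₀ p a = ∑ i, inner ℂ ((trivializationAt F E p₀).symm p (Module.finBasis ℂ F i))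
      ((trivializationAt F E p₀).symm p a) • Module.finBasis ℂ F i := by
  have ha := symm_eq_sum hp a
  rw [ha, gram]
  simp only [FunLike.coe_sum, Finset.sum_apply, smul_apply,
    ContinuousLinearMap.smulRight_apply, LinearMap.coe_toContinuousLinearMap',
    Module.Basis.coord_apply, inner_sum, Finset.sum_smul, inner_smul_right, smul_smul]
  refine Finset.sum_congr rfl fun i _ => Finset.sum_congr rfl fun j _ => ?_
  rw [mul_comm]

/-- Conjugate linearity in the first slot, since the coordinates of `gram c` are the inner products
of the basis vectors with `c`. All statements about the metric reduce to this formula. -/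
lemma inner_symm_symm {p₀ p : M} (hp : p ∈ (trivializationAt F E p₀).baseSet) (a c : F) :
    inner ℂ ((trivializationAt F E p₀).symm p a) ((trivializationAt F E p₀).symm p c) =
      ∑ i, star ((Module.finBasis ℂ F).repr a i) *
        (Module.finBasis ℂ F).repr (gram F E p₀ p c) i := by
  have ha := symm_eq_sum hp a
  conv_lhs => rw [ha]
  rw [sum_inner]
  refine Finset.sum_congr rfl fun i _ => ?_
  rw [inner_smul_left, gram_apply hp, (Module.finBasis ℂ F).repr_sum_self]
  rfl

/-- Definiteness of the metric makes the Gram operator injective, and injectivity is bijectivity in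
finite dimension. -/
lemma isUnit_gram {p₀ p : M} (hp : p ∈ (trivializationAt F E p₀).baseSet) :
    IsUnit (gram F E p₀ p) := by
  have : CompleteSpace F := FiniteDimensional.complete ℂ F
  have hinj : Function.Injective (gram F E p₀ p) := by
    rw [injective_iff_map_eq_zero]
    intro a ha
    have h0 : (trivializationAt F E p₀).symm p a = 0 := by
      rw [← inner_self_eq_zero (𝕜 := ℂ), inner_symm_symm hp, ha]
      simp
    have := congrArg (fun v => (trivializationAt F E p₀ ⟨p, v⟩).2) h0
    simp only [(trivializationAt F E p₀).apply_mk_symm hp] at this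
    rw [this]
    exact ((trivializationAt F E p₀).linear ℂ hp).map_zero
  rw [ContinuousLinearMap.isUnit_iff_bijective]
  exact ⟨hinj, LinearMap.injective_iff_surjective (f := (gram F E p₀ p).toLinearMap) |>.1 hinj⟩

lemma contMDiffOn_gram (hE : IsSmoothHermitian n F E) (p₀ : M) :
    ContMDiffOn (𝓡∂ (n + 1)) 𝓘(ℝ, F →L[ℂ] F) ∞ (gram F E p₀)
      (trivializationAt F E p₀).baseSet := by
  intro p hp
  refine ContMDiffAt.contMDiffWithinAt ?_
  unfold gram
  refine ContMDiffAt.sum fun i _ => ContMDiffAt.sum fun j _ => contMDiffAt_complex_smul ?_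
    contMDiffAt_const
  exact (hE p₀ _ _).contMDiffAt ((trivializationAt F E p₀).open_baseSet.mem_nhds hp)

lemma contMDiffOn_inverse_gram (hE : IsSmoothHermitian n F E) (p₀ : M) :
    ContMDiffOn (𝓡∂ (n + 1)) 𝓘(ℝ, F →L[ℂ] F) ∞ (fun p => Ring.inverse (gram F E p₀ p))
      (trivializationAt F E p₀).baseSet := by
  have : CompleteSpace F := FiniteDimensional.complete ℂ F
  intro p hp
  obtain ⟨u, hu⟩ := isUnit_gram hp
  have h := contDiffAt_ringInverse (n := ∞) ℝ u
  rw [hu] at h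
  exact h.comp_contMDiffWithinAt (contMDiffOn_gram hE p₀ p hp)

lemma inverse_gram_gram {p₀ p : M} (hp : p ∈ (trivializationAt F E p₀).baseSet) (a : F) :
    Ring.inverse (gram F E p₀ p) (gram F E p₀ p a) = a := by
  rw [← mul_apply_eq_comp, Ring.inverse_mul_cancel _ (isUnit_gram hp)]
  rfl

/-- The Hermitian norm is locally bounded by the norm of the model fiber. -/
lemma exists_norm_symm_le (hE : IsSmoothHermitian n F E) (p₀ : M) :
    ∃ C : ℝ, 0 ≤ C ∧ ∀ᶠ p in 𝓝 p₀, ∀ a : F, ‖(trivializationAt F E p₀).symm p a‖ ≤ C * ‖a‖ := by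
  have hp₀ := FiberBundle.mem_baseSet_trivializationAt' (F := F) (E := E) p₀
  have hnh := (trivializationAt F E p₀).open_baseSet.mem_nhds hp₀
  have hcont : ∀ i, ContinuousAt
      (fun p => ‖(trivializationAt F E p₀).symm p (Module.finBasis ℂ F i)‖) p₀ := by
    intro i
    have h := ((hE p₀ (Module.finBasis ℂ F i) (Module.finBasis ℂ F i)).contMDiffAt hnh).continuousAt
    have h2 := (Complex.continuous_re.continuousAt.comp h).sqrt
    refine h2.congr (Filter.Eventually.of_forall fun p => ?_)
    exact (norm_eq_sqrt_re_inner (𝕜 := ℂ) _).symm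
  -- The bound comes from expanding `a` in the basis: `c i` bounds the `i`-th coordinate, and near
  -- `p₀` the `i`-th basis section has norm at most its value at `p₀` plus one.
  let c : Fin (Module.finrank ℂ F) → ℝ :=
    fun i => ‖LinearMap.toContinuousLinearMap ((Module.finBasis ℂ F).coord i)‖
  refine ⟨∑ i, c i * (‖(trivializationAt F E p₀).symm p₀ (Module.finBasis ℂ F i)‖ + 1),
    by positivity, ?_⟩
  have hev : ∀ᶠ p in 𝓝 p₀, ∀ i, ‖(trivializationAt F E p₀).symm p (Module.finBasis ℂ F i)‖ <
      ‖(trivializationAt F E p₀).symm p₀ (Module.finBasis ℂ F i)‖ + 1 :=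
    Filter.eventually_all.2 fun i => (hcont i).eventually_lt_const (lt_add_one _)
  filter_upwards [hnh, hev] with p hp hpi a
  have ha := symm_eq_sum hp a
  rw [ha, Finset.sum_mul]
  refine (norm_sum_le _ _).trans (Finset.sum_le_sum fun i _ => ?_)
  rw [norm_smul]
  have h1 : ‖(Module.finBasis ℂ F).repr a i‖ ≤ c i * ‖a‖ :=
    (LinearMap.toContinuousLinearMap ((Module.finBasis ℂ F).coord i)).le_opNorm a
  calc _ ≤ (c i * ‖a‖) * (‖(trivializationAt F E p₀).symm p₀ (Module.finBasis ℂ F i)‖ + 1) := by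
        gcongr
        exact (hpi i).le
    _ = _ := by ring

/-- The norm of the model fiber is locally bounded by the Hermitian norm. -/
lemma exists_norm_le_norm_symm (hE : IsSmoothHermitian n F E) (p₀ : M) :
    ∃ C : ℝ, 0 ≤ C ∧ ∀ᶠ p in 𝓝 p₀, ∀ a : F, ‖a‖ ≤ C * ‖(trivializationAt F E p₀).symm p a‖ := by
  have hp₀ := FiberBundle.mem_baseSet_trivializationAt' (F := F) (E := E) p₀
  have hnh := (trivializationAt F E p₀).open_baseSet.mem_nhds hp₀
  obtain ⟨C, hC, hC'⟩ := exists_norm_symm_le hE p₀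
  have hinv : ∀ᶠ p in 𝓝 p₀, ‖Ring.inverse (gram F E p₀ p)‖ <
      ‖Ring.inverse (gram F E p₀ p₀)‖ + 1 :=
    (((contMDiffOn_inverse_gram hE p₀).contMDiffAt hnh).continuousAt.norm).eventually_lt_const
      (lt_add_one _)
  -- Here `a = G⁻¹ (G a)` for the Gram operator `G`: `G⁻¹` is bounded near `p₀` by continuity, and
  -- `G a` by the Cauchy–Schwarz inequality applied to its coordinates.
  refine ⟨(‖Ring.inverse (gram F E p₀ p₀)‖ + 1) *
    ∑ i, (C * ‖Module.finBasis ℂ F i‖) * ‖Module.finBasis ℂ F i‖, by positivity, ?_⟩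
  filter_upwards [hnh, hC', hinv] with p hp hpC hpi a
  calc ‖a‖ = ‖Ring.inverse (gram F E p₀ p) (gram F E p₀ p a)‖ := by rw [inverse_gram_gram hp]
    _ ≤ ‖Ring.inverse (gram F E p₀ p)‖ * ‖gram F E p₀ p a‖ := ContinuousLinearMap.le_opNorm _ _
    _ ≤ (‖Ring.inverse (gram F E p₀ p₀)‖ + 1) *
      ((∑ i, (C * ‖Module.finBasis ℂ F i‖) * ‖Module.finBasis ℂ F i‖) *
        ‖(trivializationAt F E p₀).symm p a‖) := by
        gcongr
        rw [gram_apply hp, Finset.sum_mul]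
        refine (norm_sum_le _ _).trans (Finset.sum_le_sum fun i _ => ?_)
        rw [norm_smul]
        calc _ ≤ (‖(trivializationAt F E p₀).symm p (Module.finBasis ℂ F i)‖ *
              ‖(trivializationAt F E p₀).symm p a‖) * ‖Module.finBasis ℂ F i‖ := by
              gcongr
              exact norm_inner_le_norm _ _
          _ ≤ ((C * ‖Module.finBasis ℂ F i‖) *
              ‖(trivializationAt F E p₀).symm p a‖) * ‖Module.finBasis ℂ F i‖ := by
              gcongr
              exact hpC _
          _ = _ := by ring
    _ = _ := by ring

lemma inner_eq_sum_localRep {p₀ p : M} (hp : p ∈ (trivializationAt F E p₀).baseSet)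
    (s t : ∀ p, E p) :
    inner ℂ (s p) (t p) = ∑ i, star ((Module.finBasis ℂ F).repr (localRep F p₀ s p) i) *
        (Module.finBasis ℂ F).repr (gram F E p₀ p (localRep F p₀ t p)) i := by
  rw [← inner_symm_symm hp, symm_localRep p₀ s hp, symm_localRep p₀ t hp]

end Gram

/-! ### Bundle homomorphisms: adjoints and norm bounds. -/

section SmoothHom

variable {n : ℕ} {M : Type*} [TopologicalSpace M] [ChartedSpace (EuclideanHalfSpace (n + 1)) M]
  [IsManifold (𝓡∂ (n + 1)) ∞ M]
  {FE : Type*} [NormedAddCommGroup FE] [NormedSpace ℂ FE]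
  {E : M → Type*} [TopologicalSpace (TotalSpace FE E)] [∀ p, NormedAddCommGroup (E p)]
  [∀ p, InnerProductSpace ℂ (E p)] [FiberBundle FE E] [VectorBundle ℂ FE E]
  {FF : Type*} [NormedAddCommGroup FF] [NormedSpace ℂ FF]
  {F : M → Type*} [TopologicalSpace (TotalSpace FF F)] [∀ p, NormedAddCommGroup (F p)]
  [∀ p, InnerProductSpace ℂ (F p)] [FiberBundle FF F] [VectorBundle ℂ FF F]

lemma contMDiffAt_complex_clm_apply {g : M → FE →L[ℂ] FF} {f : M → FE} {p : M}
    (hg : ContMDiffAt (𝓡∂ (n + 1)) 𝓘(ℝ, FE →L[ℂ] FF) ∞ g p)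
    (hf : ContMDiffAt (𝓡∂ (n + 1)) 𝓘(ℝ, FE) ∞ f p) :
    ContMDiffAt (𝓡∂ (n + 1)) 𝓘(ℝ, FF) ∞ (fun p => g p (f p)) p := by
  have h := (ContinuousLinearMap.restrictScalarsL ℂ FE FF ℝ ℝ).contDiff.contDiffAt.comp_contMDiffAt
    (n := ∞) hg
  exact h.clm_apply hf

/-- The function `m` represents the bundle homomorphism `T` over `U` in the trivializations
around `p₀`. -/
def IsLocalMatrix (T : ∀ p, E p →ₗ[ℂ] F p) (p₀ : M) (U : Set M) (m : M → FE →L[ℂ] FF) : Prop :=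
  U ∈ 𝓝 p₀ ∧ IsOpen U ∧ U ⊆ (trivializationAt FE E p₀).baseSet ∩ (trivializationAt FF F p₀).baseSet ∧
  ContMDiffOn (𝓡∂ (n + 1)) 𝓘(ℝ, FE →L[ℂ] FF) ∞ m U ∧
  ∀ p ∈ U, ∀ v, (trivializationAt FF F p₀ ⟨p, T p v⟩).2 = m p (trivializationAt FE E p₀ ⟨p, v⟩).2

lemma contMDiffAt_inner [FiniteDimensional ℂ FF] (hF : IsSmoothHermitian n FF F)
    {s t : ∀ p, F p} {p₀ p : M} (hp : p ∈ (trivializationAt FF F p₀).baseSet)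
    (hs : ContMDiffAt (𝓡∂ (n + 1)) 𝓘(ℝ, FF) ∞ (localRep FF p₀ s) p)
    (ht : ContMDiffAt (𝓡∂ (n + 1)) 𝓘(ℝ, FF) ∞ (localRep FF p₀ t) p) :
    ContMDiffAt (𝓡∂ (n + 1)) 𝓘(ℝ, ℂ) ∞ (fun p => inner ℂ (s p) (t p)) p := by
  have hnh := (trivializationAt FF F p₀).open_baseSet.mem_nhds hp
  have hcoord : ∀ i, ContDiff ℝ ∞ fun a : FF => (Module.finBasis ℂ FF).repr a i := fun i =>
    ((LinearMap.toContinuousLinearMap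
      ((Module.finBasis ℂ FF).coord i)).restrictScalars ℝ).contDiff
  have h : ContMDiffAt (𝓡∂ (n + 1)) 𝓘(ℝ, ℂ) ∞ (fun p => ∑ i,
      star ((Module.finBasis ℂ FF).repr (localRep FF p₀ s p) i) *
        (Module.finBasis ℂ FF).repr (gram FF F p₀ p (localRep FF p₀ t p)) i) p := by
    refine ContMDiffAt.sum fun i _ => ?_
    have h1 := Complex.conjCLE.contDiff.contDiffAt.comp_contMDiffAt
      (n := ∞) ((hcoord i).contDiffAt.comp_contMDiffAt hs)
    have h2 := (hcoord i).contDiffAt.comp_contMDiffAt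
      (contMDiffAt_complex_clm_apply ((contMDiffOn_gram hF p₀).contMDiffAt hnh) ht)
    exact contMDiffAt_complex_smul h1 h2
  refine h.congr_of_eventuallyEq ?_
  filter_upwards [hnh] with y hy
  exact inner_eq_sum_localRep hy s t

/-- The value at `p` of the adjoint of `T` applied to `w`, computed in the trivialization
around `p₀`. -/
def localAdjoint [FiniteDimensional ℂ FE] (T : ∀ p, E p →ₗ[ℂ] F p) (p₀ p : M) (w : F p) : E p :=
  (trivializationAt FE E p₀).symm p (Ring.inverse (gram FE E p₀ p)
    (∑ i, inner ℂ (T p ((trivializationAt FE E p₀).symm p (Module.finBasis ℂ FE i))) w •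
      Module.finBasis ℂ FE i))

/-- The Gram operator cancels its inverse in `localAdjoint`, leaving the coordinates `⟨T b_i, w⟩`.
The resulting identity determines the vector, so it does not depend on the trivialization used. -/
lemma inner_localAdjoint [FiniteDimensional ℂ FE] (T : ∀ p, E p →ₗ[ℂ] F p) {p₀ p : M}
    (hp : p ∈ (trivializationAt FE E p₀).baseSet) (v : E p) (w : F p) :
    inner ℂ v (localAdjoint (FE := FE) T p₀ p w) = inner ℂ (T p v) w := by
  obtain ⟨a, rfl⟩ : ∃ a, (trivializationAt FE E p₀).symm p a = v :=
    ⟨_, (trivializationAt FE E p₀).symm_apply_apply_mk hp v⟩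
  rw [localAdjoint, inner_symm_symm hp, ← mul_apply_eq_comp,
    Ring.mul_inverse_cancel _ (isUnit_gram hp), symm_eq_sum hp a]
  rw [one_apply_eq_self, map_sum (T p), sum_inner]
  refine Finset.sum_congr rfl fun i _ => ?_
  rw [map_smul, inner_smul_left, (Module.finBasis ℂ FE).repr_sum_self]
  rfl

/-- A smooth bundle homomorphism has an adjoint, which maps smooth sections to smooth sections. -/
lemma exists_adjoint_section [FiniteDimensional ℂ FE] [FiniteDimensional ℂ FF]
    [VectorBundle ℝ FE E] [ContMDiffVectorBundle ∞ FE E (𝓡∂ (n + 1))]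
    [VectorBundle ℝ FF F] [ContMDiffVectorBundle ∞ FF F (𝓡∂ (n + 1))]
    (hE : IsSmoothHermitian n FE E) (hF : IsSmoothHermitian n FF F)
    (T : ∀ p, E p →ₗ[ℂ] F p)
    (hT : ∀ p₀, ∃ (U : Set M) (m : M → FE →L[ℂ] FF), IsLocalMatrix (n := n) T p₀ U m)
    (t : smoothSections n FF F) :
    ∃ r : smoothSections n FE E, (∀ p (v : E p),
      inner ℂ v ((r : ∀ p, E p) p) = inner ℂ (T p v) ((t : ∀ p, F p) p)) ∧
      ∀ p, (t : ∀ p, F p) p = 0 → (r : ∀ p, E p) p = 0 := by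
  have hr : ∀ p (v : E p), inner ℂ v (localAdjoint (FE := FE) T p p ((t : ∀ p, F p) p)) =
      inner ℂ (T p v) ((t : ∀ p, F p) p) := fun p v =>
    inner_localAdjoint T (FiberBundle.mem_baseSet_trivializationAt' p) v _
  refine ⟨⟨fun p => localAdjoint (FE := FE) T p p ((t : ∀ p, F p) p), fun p₀ => ?_⟩, hr, ?_⟩
  · obtain ⟨U, m, hU, hUo, hUb, hm, hTm⟩ := hT p₀
    have hp₀ := FiberBundle.mem_baseSet_trivializationAt' (F := FE) (E := E) p₀
    have hp₀' := FiberBundle.mem_baseSet_trivializationAt' (F := FF) (E := F) p₀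
    have hnh := (trivializationAt FE E p₀).open_baseSet.mem_nhds hp₀
    rw [contMDiffAt_section_iff_localRep hp₀]
    have hinner : ∀ i, ContMDiffAt (𝓡∂ (n + 1)) 𝓘(ℝ, ℂ) ∞ (fun p => inner ℂ
        (T p ((trivializationAt FE E p₀).symm p (Module.finBasis ℂ FE i)))
        ((t : ∀ p, F p) p)) p₀ := by
      intro i
      refine contMDiffAt_inner (s := fun p =>
        T p ((trivializationAt FE E p₀).symm p (Module.finBasis ℂ FE i))) hF hp₀' ?_
        ((contMDiffAt_section_iff_localRep hp₀').1 (t.2 p₀))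
      refine (contMDiffAt_complex_clm_apply (hm.contMDiffAt hU)
        (contMDiffAt_const (c := Module.finBasis ℂ FE i))).congr_of_eventuallyEq ?_
      filter_upwards [hU] with y hy
      rw [localRep, hTm y hy, (trivializationAt FE E p₀).apply_mk_symm (hUb hy).1]
    have hsum : ContMDiffAt (𝓡∂ (n + 1)) 𝓘(ℝ, FE) ∞ (fun p => ∑ i, inner ℂ
        (T p ((trivializationAt FE E p₀).symm p (Module.finBasis ℂ FE i)))
        ((t : ∀ p, F p) p) • Module.finBasis ℂ FE i) p₀ :=
      ContMDiffAt.sum fun i _ => contMDiffAt_complex_smul (hinner i) contMDiffAt_const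
    refine (contMDiffAt_complex_clm_apply ((contMDiffOn_inverse_gram hE p₀).contMDiffAt hnh)
      hsum).congr_of_eventuallyEq ?_
    filter_upwards [hnh] with y hy
    -- The section is defined at each point by the trivialization around that point. Uniqueness of
    -- the adjoint replaces it by the fixed trivialization around `p₀`, where smoothness is visible.
    have heq : localAdjoint (FE := FE) T y y ((t : ∀ p, F p) y) =
        localAdjoint (FE := FE) T p₀ y ((t : ∀ p, F p) y) := by
      refine ext_inner_left ℂ fun v => ?_
      rw [hr, inner_localAdjoint T hy]
    rw [localRep, heq, localAdjoint, (trivializationAt FE E p₀).apply_mk_symm hy]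
  · intro p hp
    rw [← inner_self_eq_zero (𝕜 := ℂ), hr]
    simp [hp]

/-- A bound near every point of a compact space gives a global bound. -/
lemma exists_forall_le_of_forall_eventually {X : Type*} [TopologicalSpace X] [CompactSpace X]
    {Q : X → ℝ → Prop} (hmono : ∀ p C C', C ≤ C' → Q p C → Q p C')
    (h : ∀ p₀, ∃ C, ∀ᶠ p in 𝓝 p₀, Q p C) : ∃ C, 0 ≤ C ∧ ∀ p, Q p C := by
  have := isCompact_univ.induction_on (X := X) (p := fun S => ∃ C, ∀ p ∈ S, Q p C)
    ⟨0, by simp⟩ (fun S T hST ⟨C, hC⟩ => ⟨C, fun p hp => hC p (hST hp)⟩)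
    (fun S T ⟨C, hC⟩ ⟨C', hC'⟩ => ⟨max C C', by
      rintro p (hp | hp)
      · exact hmono _ _ _ (le_max_left _ _) (hC p hp)
      · exact hmono _ _ _ (le_max_right _ _) (hC' p hp)⟩)
    (fun p₀ _ => by
      obtain ⟨C, hC⟩ := h p₀
      exact ⟨{p | Q p C}, mem_nhdsWithin_of_mem_nhds hC, C, fun p hp => hp⟩)
  obtain ⟨C, hC⟩ := this
  exact ⟨max C 0, le_max_right _ _, fun p => hmono _ _ _ (le_max_left _ _) (hC p (mem_univ p))⟩

/-- A smooth bundle homomorphism whose local matrices are bounded by the nonnegative function `x`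
is bounded by a multiple of `x` in the Hermitian norms. -/
lemma exists_norm_hom_le [CompactSpace M] [FiniteDimensional ℂ FE] [FiniteDimensional ℂ FF]
    (hE : IsSmoothHermitian n FE E) (hF : IsSmoothHermitian n FF F) {x : M → ℝ} (hx : ∀ p, 0 ≤ x p)
    (T : ∀ p, E p →ₗ[ℂ] F p)
    (hT : ∀ p₀, ∃ (U : Set M) (m : M → FE →L[ℂ] FF) (C : ℝ), IsLocalMatrix (n := n) T p₀ U m ∧
      ∀ᶠ p in 𝓝 p₀, ‖m p‖ ≤ C * x p) :
    ∃ C : ℝ, 0 ≤ C ∧ ∀ p (v : E p), ‖T p v‖ ≤ C * x p * ‖v‖ := by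
  refine exists_forall_le_of_forall_eventually (Q := fun p C => ∀ v : E p, ‖T p v‖ ≤ C * x p * ‖v‖)
    (fun p C C' hCC' h v => (h v).trans (by have := hx p; gcongr)) fun p₀ => ?_
  obtain ⟨U, m, C, ⟨hU, -, hUb, -, hTm⟩, hmC⟩ := hT p₀
  obtain ⟨c₁, hc₁, h₁⟩ := exists_norm_symm_le hF p₀
  obtain ⟨c₂, hc₂, h₂⟩ := exists_norm_le_norm_symm hE p₀
  refine ⟨c₁ * C * c₂, ?_⟩
  filter_upwards [hU, hmC, h₁, h₂] with p hp hmp hp₁ hp₂ v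
  have hb := hUb hp
  calc ‖T p v‖ = ‖(trivializationAt FF F p₀).symm p (m p (trivializationAt FE E p₀ ⟨p, v⟩).2)‖ := by
        rw [← hTm p hp, (trivializationAt FF F p₀).symm_apply_apply_mk hb.2]
    _ ≤ c₁ * ((C * x p) * (c₂ * ‖v‖)) := by
        refine (hp₁ _).trans ?_
        gcongr
        refine ((m p).le_opNorm _).trans ?_
        have h3 : ‖(trivializationAt FE E p₀ ⟨p, v⟩).2‖ ≤ c₂ * ‖v‖ := by
          have := hp₂ (trivializationAt FE E p₀ ⟨p, v⟩).2
          rwa [(trivializationAt FE E p₀).symm_apply_apply_mk hb.1] at this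
        -- The sign of `C` is not known; `C * x p` is nonnegative because it bounds a norm.
        exact mul_le_mul hmp h3 (norm_nonneg _) ((norm_nonneg _).trans hmp)
    _ = _ := by ring

end SmoothHom

/-! ### Functions vanishing on the boundary of a half space. -/

section HalfSpace

variable {n : ℕ} {V : Type*} [NormedAddCommGroup V] [NormedSpace ℝ V]

/-- The orthogonal projection to the boundary of the half space. -/
def boundaryProj (v : EuclideanSpace ℝ (Fin (n + 1))) : EuclideanSpace ℝ (Fin (n + 1)) :=
  v - v 0 • EuclideanSpace.single 0 1

lemma boundaryProj_zero (v : EuclideanSpace ℝ (Fin (n + 1))) : boundaryProj v 0 = 0 := by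
  simp [boundaryProj]

lemma sub_boundaryProj (v : EuclideanSpace ℝ (Fin (n + 1))) :
    v - boundaryProj v = v 0 • EuclideanSpace.single 0 1 := by
  simp [boundaryProj]

lemma norm_sub_boundaryProj {v : EuclideanSpace ℝ (Fin (n + 1))} (hv : 0 ≤ v 0) :
    ‖v - boundaryProj v‖ = v 0 := by
  rw [sub_boundaryProj, norm_smul]
  simp [abs_of_nonneg hv]

lemma tendsto_boundaryProj {a : EuclideanSpace ℝ (Fin (n + 1))} (ha : a 0 = 0) :
    Filter.Tendsto boundaryProj (𝓝 a) (𝓝[{v | 0 ≤ v 0}] a) := by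
  refine tendsto_nhdsWithin_iff.2 ⟨?_, Filter.Eventually.of_forall fun v => ?_⟩
  · have h : Continuous (boundaryProj (n := n)) := by
      unfold boundaryProj
      fun_prop
    have h2 := h.tendsto a
    rwa [show boundaryProj a = a by simp [boundaryProj, ha]] at h2
  · simp [boundaryProj_zero]

lemma convex_halfSpace : Convex ℝ {v : EuclideanSpace ℝ (Fin (n + 1)) | 0 ≤ v 0} := by
  intro u hu v hv a b ha hb _
  simp only [mem_ofPred_eq] at *
  simp only [PiLp.add_apply, PiLp.smul_apply, smul_eq_mul]
  positivity

/-- A `C¹` function on the half space that vanishes on the boundary is bounded by the distance to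
the boundary. -/
lemma exists_norm_le_of_eq_zero_on_boundary {h : EuclideanSpace ℝ (Fin (n + 1)) → V}
    {a : EuclideanSpace ℝ (Fin (n + 1))} (ha : a 0 = 0)
    (hh : ContDiffWithinAt ℝ 1 h {v | 0 ≤ v 0} a)
    (h0 : ∀ᶠ v in 𝓝[{v | 0 ≤ v 0}] a, v 0 = 0 → h v = 0) :
    ∃ C : ℝ, 0 ≤ C ∧ ∀ᶠ v in 𝓝[{v | 0 ≤ v 0}] a, ‖h v‖ ≤ C * v 0 := by
  obtain ⟨K, t, ht, hK⟩ := hh.exists_lipschitzOnWith convex_halfSpace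
  refine ⟨K, K.2, ?_⟩
  have hproj := (tendsto_boundaryProj ha).mono_left (nhdsWithin_le_nhds (s := {v | 0 ≤ v 0}))
  filter_upwards [ht, hproj.eventually ht, hproj.eventually h0, self_mem_nhdsWithin]
    with v hv hpv h0v hv0
  -- Compare `v` with its boundary projection, where `h` vanishes and whose distance from `v` is `v
  -- 0`.
  have := hK.norm_sub_le hv hpv
  rwa [h0v (boundaryProj_zero v), sub_zero, norm_sub_boundaryProj hv0] at this

/-- A `C¹` function on the half space that vanishes on the boundary and has nonvanishing
differential is bounded below by the distance to the boundary. -/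
lemma exists_le_norm_of_fderivWithin_ne_zero {h : EuclideanSpace ℝ (Fin (n + 1)) → V}
    {a : EuclideanSpace ℝ (Fin (n + 1))} (ha : a 0 = 0)
    (hh : ContDiffWithinAt ℝ 1 h {v | 0 ≤ v 0} a)
    (h0 : ∀ᶠ v in 𝓝[{v | 0 ≤ v 0}] a, v 0 = 0 → h v = 0)
    (hd : fderivWithin ℝ h {v | 0 ≤ v 0} a ≠ 0) :
    ∃ c : ℝ, 0 < c ∧ ∀ᶠ v in 𝓝[{v | 0 ≤ v 0}] a, c * v 0 ≤ ‖h v‖ := by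
  set H : Set (EuclideanSpace ℝ (Fin (n + 1))) := {v | 0 ≤ v 0} with hH
  have haH : a ∈ H := ha.ge
  have huH : UniqueDiffOn ℝ H := by
    refine uniqueDiffOn_convex convex_halfSpace ⟨EuclideanSpace.single 0 1, ?_⟩
    refine mem_interior.2 ⟨{v | 0 < v 0}, fun v hv => (show (0 : ℝ) < v 0 from hv).le, ?_, by simp⟩
    exact isOpen_lt continuous_const (by fun_prop)
  set L := fderivWithin ℝ h H a with hL
  have hLd : HasFDerivWithinAt h L H a := (hh.differentiableWithinAt one_ne_zero).hasFDerivWithinAt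
  -- the differential vanishes in tangential directions
  have htan : ∀ w : EuclideanSpace ℝ (Fin (n + 1)), w 0 = 0 → L w = 0 := by
    intro w hw
    have hline : HasDerivAt (fun t : ℝ => a + t • w) w 0 := by
      simpa using ((hasDerivAt_id (0 : ℝ)).smul_const w).const_add a
    have hmem : ∀ t : ℝ, a + t • w ∈ H := fun t => by simp [hH, ha, hw]
    have h1 : HasDerivAt (fun t : ℝ => h (a + t • w)) (L w) 0 := by
      have hLd' : HasFDerivWithinAt h L H (a + (0 : ℝ) • w) := by simpa using hLd
      have := hLd'.comp_hasDerivWithinAt (0 : ℝ) (hline.hasDerivWithinAt (s := univ))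
        (fun t _ => hmem t)
      simpa using! this
    have h2 : HasDerivAt (fun t : ℝ => h (a + t • w)) 0 0 := by
      refine (hasDerivAt_const (0 : ℝ) (0 : V)).congr_of_eventuallyEq ?_
      have hlim : Filter.Tendsto (fun t : ℝ => a + t • w) (𝓝 0) (𝓝[H] a) := by
        refine tendsto_nhdsWithin_iff.2 ⟨?_, Filter.Eventually.of_forall hmem⟩
        simpa using hline.continuousAt.tendsto
      filter_upwards [hlim.eventually h0] with t ht
      exact ht (by simp [ha, hw])
    exact h1.unique h2
  set ℓ : V := L (EuclideanSpace.single 0 1) with hℓ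
  have hLv : ∀ v, L v = v 0 • ℓ := by
    intro v
    have h1 := htan _ (boundaryProj_zero v)
    rw [boundaryProj, map_sub, map_smul, sub_eq_zero] at h1
    exact h1
  have hℓ0 : 0 < ‖ℓ‖ := by
    refine norm_pos_iff.2 fun h => hd ?_
    ext v
    simp [hLv, h]
  -- on a small half ball the differential is close to `L`
  obtain ⟨u, huo, hau, hu⟩ := hh.contDiffOn' le_rfl (by simp)
  rw [insert_eq_of_mem haH] at hu
  have huo' : UniqueDiffOn ℝ (H ∩ u) := huH.inter huo
  have hcont := hu.continuousOn_fderivWithin huo' le_rfl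
  have hLu : fderivWithin ℝ h (H ∩ u) a = L := fderivWithin_inter (huo.mem_nhds hau)
  -- The tolerance `‖ℓ‖ / 2` leaves half of the normal derivative `ℓ` available for the lower bound.
  have hev : ∀ᶠ v in 𝓝[H ∩ u] a, ‖fderivWithin ℝ h (H ∩ u) v - L‖ < ‖ℓ‖ / 2 := by
    have h1 := (hcont a ⟨haH, hau⟩).sub (continuousWithinAt_const (b := L))
    have h2 := h1.norm
    refine h2.eventually_lt_const ?_
    simp only [Pi.sub_apply, hLu, sub_self, norm_zero]
    positivity
  obtain ⟨r, hr, hball⟩ := Metric.mem_nhdsWithin_iff.1 (Filter.inter_mem hev self_mem_nhdsWithin)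
  obtain ⟨r', hr', hball'⟩ := Metric.isOpen_iff.1 huo a hau
  set W := Metric.ball a (min r r') ∩ H with hW
  have hWsub : W ⊆ H ∩ u := fun v hv =>
    ⟨hv.2, hball' (Metric.ball_subset_ball (min_le_right _ _) hv.1)⟩
  have hWc : Convex ℝ W := (convex_ball _ _).inter convex_halfSpace
  have hWn : W ∈ 𝓝[H] a := Filter.inter_mem
    (mem_nhdsWithin_of_mem_nhds (Metric.ball_mem_nhds _ (by positivity))) self_mem_nhdsWithin
  -- Mean value inequality for `h - L` on the convex half ball `W`.
  have hest : ∀ v ∈ W, ∀ w ∈ W, ‖h w - h v - L (w - v)‖ ≤ ‖ℓ‖ / 2 * ‖w - v‖ := by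
    intro v hv w hw
    refine hWc.norm_image_sub_le_of_norm_hasFDerivWithin_le'
      (f' := fun v => fderivWithin ℝ h (H ∩ u) v) (fun y hy => ?_) (fun y hy => ?_) hv hw
    · exact ((hu.differentiableOn one_ne_zero y (hWsub hy)).hasFDerivWithinAt).mono hWsub
    · exact le_of_lt (hball ⟨Metric.ball_subset_ball (min_le_left _ _) hy.1, hWsub hy⟩).1
  refine ⟨‖ℓ‖ / 2, by positivity, ?_⟩
  have hproj := (tendsto_boundaryProj ha).mono_left (nhdsWithin_le_nhds (s := H))
  filter_upwards [hWn, hproj.eventually hWn, hproj.eventually h0, self_mem_nhdsWithin]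
    with v hv hpv h0v hv0
  -- Applied to `v` and its projection this reads `‖h v - v 0 • ℓ‖ ≤ ‖ℓ‖ / 2 * v 0`, and the reverse
  -- triangle inequality finishes.
  have h1 := hest _ hpv _ hv
  rw [h0v (boundaryProj_zero v), sub_zero, norm_sub_boundaryProj hv0, hLv, sub_boundaryProj] at h1
  have h2 : ‖((v 0 • EuclideanSpace.single 0 1 : EuclideanSpace ℝ (Fin (n + 1))) 0) • ℓ‖ =
      v 0 * ‖ℓ‖ := by
    rw [norm_smul]
    simp [abs_of_nonneg (show 0 ≤ v 0 from hv0)]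
  have h3 := norm_sub_norm_le (((v 0 • EuclideanSpace.single 0 1 :
    EuclideanSpace ℝ (Fin (n + 1))) 0) • ℓ) (h v)
  rw [norm_sub_rev, h2] at h3
  linarith

end HalfSpace

/-! ### Division by the defining function, as an estimate. -/

section BoundaryBound

variable {n : ℕ} {M : Type*} [TopologicalSpace M] [ChartedSpace (EuclideanHalfSpace (n + 1)) M]
  [IsManifold (𝓡∂ (n + 1)) ∞ M] {V : Type*} [NormedAddCommGroup V] [NormedSpace ℝ V]

lemma IsDefiningFunction.nonneg {x : M → ℝ} (hx : IsDefiningFunction (n := n) x) (p : M) :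
    0 ≤ x p := by
  rcases (𝓡∂ (n + 1)).isInteriorPoint_or_isBoundaryPoint p with hp | hp
  · exact (hx.pos p hp).le
  · exact (hx.eq_zero p hp).ge

lemma range_halfSpaceModel :
    range (𝓡∂ (n + 1)) = {v : EuclideanSpace ℝ (Fin (n + 1)) | 0 ≤ v 0} :=
  range_modelWithCornersEuclideanHalfSpace (n + 1)

lemma extChartAt_zero_eq_zero {p : M} (hp : p ∈ (𝓡∂ (n + 1)).boundary M) :
    extChartAt (𝓡∂ (n + 1)) p p 0 = 0 := by
  have h : extChartAt (𝓡∂ (n + 1)) p p ∈ frontier (range (𝓡∂ (n + 1))) := hp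
  rw [frontier_range_modelWithCornersEuclideanHalfSpace] at h
  exact h.symm

/-- Being a boundary point can be tested in any chart of the atlas. A point with first coordinate
zero is not interior to the chart target, which lies in the half space. -/
lemma extChartAt_symm_mem_boundary (p₀ : M) {v : EuclideanSpace ℝ (Fin (n + 1))}
    (hv : v ∈ (extChartAt (𝓡∂ (n + 1)) p₀).target) (hv0 : v 0 = 0) :
    (extChartAt (𝓡∂ (n + 1)) p₀).symm v ∈ (𝓡∂ (n + 1)).boundary M := by
  have hsrc := (extChartAt (𝓡∂ (n + 1)) p₀).map_target hv
  rw [extChartAt_source] at hsrc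
  refine ((𝓡∂ (n + 1)).isBoundaryPoint_iff_of_mem_atlas (n := ∞) (by simp)
    (chart_mem_atlas _ p₀) hsrc).2 ?_
  change extChartAt (𝓡∂ (n + 1)) p₀ ((extChartAt (𝓡∂ (n + 1)) p₀).symm v) ∈ frontier
    (extChartAt (𝓡∂ (n + 1)) p₀).target
  rw [(extChartAt (𝓡∂ (n + 1)) p₀).right_inv hv]
  refine ⟨subset_closure hv, fun hint => ?_⟩
  have h2 := interior_mono (extChartAt_target_subset_range p₀) hint
  rw [interior_range_modelWithCornersEuclideanHalfSpace] at h2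
  exact (ne_of_gt (show 0 < v 0 from h2)) hv0

lemma eventually_comp_extChartAt_symm_eq_zero {k : M → V}
    (hk : ∀ p ∈ (𝓡∂ (n + 1)).boundary M, k p = 0) (p₀ : M) :
    ∀ᶠ v in 𝓝[{v | 0 ≤ v 0}] (extChartAt (𝓡∂ (n + 1)) p₀ p₀),
      v 0 = 0 → (k ∘ (extChartAt (𝓡∂ (n + 1)) p₀).symm) v = 0 := by
  have htar := extChartAt_target_mem_nhdsWithin (I := 𝓡∂ (n + 1)) p₀
  rw [range_halfSpaceModel] at htar
  filter_upwards [htar] with v hv hv0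
  exact hk _ (extChartAt_symm_mem_boundary p₀ hv hv0)

/-- A smooth function that vanishes on the boundary is locally bounded by a multiple of the
defining function. -/
lemma exists_norm_le_mul_definingFunction {x : M → ℝ} (hx : IsDefiningFunction (n := n) x)
    {g : M → V} (hg : ContMDiff (𝓡∂ (n + 1)) 𝓘(ℝ, V) ∞ g)
    (hg0 : ∀ p ∈ (𝓡∂ (n + 1)).boundary M, g p = 0) (p₀ : M) :
    ∃ C : ℝ, 0 ≤ C ∧ ∀ᶠ p in 𝓝 p₀, ‖g p‖ ≤ C * x p := by
  rcases (𝓡∂ (n + 1)).isInteriorPoint_or_isBoundaryPoint p₀ with hp | hp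
  · have hpos := hx.pos p₀ hp
    -- At an interior point continuity suffices: nearby `‖g‖ < ‖g p₀‖ + 1` and `x > x p₀ / 2`.
    refine ⟨(‖g p₀‖ + 1) / (x p₀ / 2), by positivity, ?_⟩
    have h1 := (hg.continuous.norm.continuousAt (x := p₀)).eventually_lt_const (lt_add_one _)
    have h2 := (hx.contMDiff.continuous.continuousAt (x := p₀)).eventually_const_lt
      (half_lt_self hpos)
    filter_upwards [h1, h2] with p h1 h2
    calc ‖g p‖ ≤ (‖g p₀‖ + 1) / (x p₀ / 2) * (x p₀ / 2) := by
          rw [div_mul_cancel₀ _ (by positivity)]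
          exact h1.le
      _ ≤ _ := by gcongr
  · set e := extChartAt (𝓡∂ (n + 1)) p₀ with he
    have ha : e p₀ 0 = 0 := extChartAt_zero_eq_zero hp
    have hgd : ContDiffWithinAt ℝ 1 (g ∘ e.symm) {v | 0 ≤ v 0} (e p₀) := by
      have := (contMDiffAt_iff.1 (hg p₀)).2
      rw [range_halfSpaceModel] at this
      exact this.of_le (by simp)
    have hxd : ContDiffWithinAt ℝ 1 (x ∘ e.symm) {v | 0 ≤ v 0} (e p₀) := by
      have := (contMDiffAt_iff.1 (hx.contMDiff p₀)).2
      rw [range_halfSpaceModel] at this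
      exact this.of_le (by simp)
    have hxne : fderivWithin ℝ (x ∘ e.symm) {v | 0 ≤ v 0} (e p₀) ≠ 0 := by
      intro h0
      rw [← range_halfSpaceModel] at h0
      exact hx.mfderiv_ne_zero p₀ hp ((hx.contMDiff.mdifferentiableAt (by simp)).mfderiv.trans h0)
    obtain ⟨C, hC, hC'⟩ := exists_norm_le_of_eq_zero_on_boundary ha hgd
      (eventually_comp_extChartAt_symm_eq_zero hg0 p₀)
    obtain ⟨c, hc, hc'⟩ := exists_le_norm_of_fderivWithin_ne_zero ha hxd
      (eventually_comp_extChartAt_symm_eq_zero hx.eq_zero p₀) hxne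
    have htend : Filter.Tendsto e (𝓝 p₀) (𝓝[{v | 0 ≤ v 0}] (e p₀)) := by
      rw [← range_halfSpaceModel]
      refine tendsto_nhdsWithin_iff.2 ⟨continuousAt_extChartAt p₀, ?_⟩
      filter_upwards [extChartAt_source_mem_nhds (I := 𝓡∂ (n + 1)) p₀] with p hp
      exact extChartAt_target_subset_range p₀ (e.map_source hp)
    -- In the chart both functions are compared with the first coordinate `v 0`: `‖g‖ ≤ C * v 0` and
    -- `c * v 0 ≤ x`.
    refine ⟨C / c, by positivity, ?_⟩
    filter_upwards [htend.eventually hC', htend.eventually hc',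
      extChartAt_source_mem_nhds (I := 𝓡∂ (n + 1)) p₀] with p h1 h2 hp
    simp only [Function.comp_apply, e.left_inv hp] at h1 h2
    rw [Real.norm_of_nonneg (hx.nonneg p)] at h2
    calc ‖g p‖ ≤ C * e p 0 := h1
      _ = C / c * (c * e p 0) := by field_simp
      _ ≤ C / c * x p := by gcongr

end BoundaryBound

/-! ### Derivatives along vector fields. -/

section Derivative

variable {n : ℕ} {M : Type*} [TopologicalSpace M] [ChartedSpace (EuclideanHalfSpace (n + 1)) M]
  [IsManifold (𝓡∂ (n + 1)) ∞ M]

variable {V : Type*} [NormedAddCommGroup V]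

/-- The derivative of the vector-valued function `g` along the vector field `X`. -/
def dirDeriv [NormedSpace ℝ V] (g : M → V) (X : ∀ p : M, TangentSpace (𝓡∂ (n + 1)) p) (p : M) : V :=
  mfderiv (𝓡∂ (n + 1)) 𝓘(ℝ, V) g p (X p)

/-- The derivative along `X` is the fiber component of the tangent map of `g` composed with the
section `X`. -/
lemma contMDiff_dirDeriv [NormedSpace ℝ V] {g : M → V}
    {X : ∀ p : M, TangentSpace (𝓡∂ (n + 1)) p} (hg : ContMDiff (𝓡∂ (n + 1)) 𝓘(ℝ, V) ∞ g)
    (hX : ContMDiff (𝓡∂ (n + 1)) (𝓡∂ (n + 1)).tangent ∞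
      (fun p => (⟨p, X p⟩ : TangentBundle (𝓡∂ (n + 1)) M))) :
    ContMDiff (𝓡∂ (n + 1)) 𝓘(ℝ, V) ∞ (dirDeriv g X) :=
  (contMDiff_snd_tangentBundle_modelSpace V 𝓘(ℝ, V)).comp
    ((hg.contMDiff_tangentMap (m := ∞) (by simp)).comp hX)

lemma dirDeriv_congr [NormedSpace ℝ V] {g h : M → V} {X : ∀ p : M, TangentSpace (𝓡∂ (n + 1)) p}
    {p : M} (hgh : g =ᶠ[𝓝 p] h) : dirDeriv g X p = dirDeriv h X p :=
  congrArg (fun L : EuclideanSpace ℝ (Fin (n + 1)) →L[ℝ] V => L (X p)) hgh.mfderiv_eq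

lemma hasMFDerivAt_complex_smul [NormedSpace ℂ V] {f : M → ℂ} {g : M → V} {p : M}
    {f' : EuclideanSpace ℝ (Fin (n + 1)) →L[ℝ] ℂ} {g' : EuclideanSpace ℝ (Fin (n + 1)) →L[ℝ] V}
    (hf : HasMFDerivAt (𝓡∂ (n + 1)) 𝓘(ℝ, ℂ) f p f')
    (hg : HasMFDerivAt (𝓡∂ (n + 1)) 𝓘(ℝ, V) g p g') :
    HasMFDerivAt (𝓡∂ (n + 1)) 𝓘(ℝ, V) (fun p => f p • g p) p
      (f p • g' + f'.smulRight (g p) : EuclideanSpace ℝ (Fin (n + 1)) →L[ℝ] V) := by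
  refine ⟨hf.1.smul hg.1, ?_⟩
  have h3 := HasFDerivWithinAt.smul hf.2 hg.2
  simp only [writtenInExtChartAt, extChartAt_model_space_eq_id, PartialEquiv.refl_coe,
    Function.comp_apply, id, extChartAt_to_inv] at h3 ⊢
  exact h3

lemma dirDeriv_complex_smul [NormedSpace ℂ V] {f : M → ℂ}
    {g : M → V} {p : M} (hf : MDifferentiableAt (𝓡∂ (n + 1)) 𝓘(ℝ, ℂ) f p)
    (hg : MDifferentiableAt (𝓡∂ (n + 1)) 𝓘(ℝ, V) g p)
    (X : ∀ p : M, TangentSpace (𝓡∂ (n + 1)) p) :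
    dirDeriv (fun p => f p • g p) X p = f p • dirDeriv g X p + dirDeriv f X p • g p :=
  congrArg (fun L : EuclideanSpace ℝ (Fin (n + 1)) →L[ℝ] V => L (X p))
    (hasMFDerivAt_complex_smul hf.hasMFDerivAt hg.hasMFDerivAt).mfderiv

end Derivative

/-! ### Edge fields, and the commutator of an edge operator with a function. -/

section Edge

variable {n : ℕ} {M : Type*} [TopologicalSpace M] [ChartedSpace (EuclideanHalfSpace (n + 1)) M]
  [IsManifold (𝓡∂ (n + 1)) ∞ M]
  {ι : Type*} {N : ι → Type u} [∀ i, TopologicalSpace (N i)]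
  [∀ i, ChartedSpace (EuclideanSpace ℝ (Fin n)) (N i)]
  {q : ι → ℕ} {Y : ι → Type*} [∀ i, TopologicalSpace (Y i)]
  [∀ i, ChartedSpace (EuclideanSpace ℝ (Fin (q i))) (Y i)]
  {emb : ∀ i, N i → M} {φ : ∀ i, N i → Y i}

/-- A smooth function that is constant on the fibers of a fibration has vanishing derivative in
vertical directions. -/
lemma mfderiv_eq_zero_of_constant_on_fibers {n k : ℕ} {P : Type u} [TopologicalSpace P]
    [ChartedSpace (EuclideanSpace ℝ (Fin n)) P] {B : Type*} [TopologicalSpace B]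
    [ChartedSpace (EuclideanSpace ℝ (Fin k)) B] {ψ : P → B}
    (hψ : IsSmoothFibration (n := n) (k := k) ψ) {g : P → ℂ}
    (hg : ContMDiff (𝓡 n) 𝓘(ℝ, ℂ) ∞ g) (hgψ : ∀ a b, ψ a = ψ b → g a = g b) (a : P)
    (τ : TangentSpace (𝓡 n) a) (hτ : mfderiv (𝓡 n) (𝓡 k) ψ a τ = 0) :
    mfderiv (𝓡 n) 𝓘(ℝ, ℂ) g a τ = 0 := by
  obtain ⟨hψs, -, hloc⟩ := hψ
  obtain ⟨V, r, Z, _, _, hV, haV, -, -, -, Φ, hΦs, hΦt, hΦ1, -, hΦinv⟩ := hloc (ψ a)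
  have ha : a ∈ Φ.source := by rw [hΦs]; exact haV
  set z := (Φ a).2
  have hmaps : ∀ b ∈ V, (b, z) ∈ Φ.target := fun b hb => by rw [hΦt]; exact ⟨hb, mem_univ _⟩
  -- Restricting `g` to the local section of `ψ` through `a` with constant fiber coordinate `z`
  -- gives a smooth function on the base. Near `a` one has `g = h ∘ ψ`, so the chain rule kills
  -- vertical vectors.
  let h : B → ℂ := fun b => g (Φ.symm (b, z))
  have hh : MDifferentiableAt (𝓡 k) 𝓘(ℝ, ℂ) h (ψ a) := by
    have h1 : ContMDiffAt (𝓡 k) (𝓡 n) ∞ (fun b => Φ.symm (b, z)) (ψ a) := by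
      have h2 := hΦinv.contMDiffAt (Φ.open_target.mem_nhds (hmaps _ haV))
      exact h2.comp (ψ a) (contMDiffAt_id.prodMk contMDiffAt_const)
    exact ((hg _).comp (ψ a) h1).mdifferentiableAt (by simp)
  have heq : g =ᶠ[𝓝 a] h ∘ ψ := by
    filter_upwards [Φ.open_source.mem_nhds ha] with b hb
    have hbV : ψ b ∈ V := by rw [hΦs] at hb; exact hb
    refine hgψ _ _ ?_
    have hm := Φ.map_target (hmaps _ hbV)
    rw [← hΦ1 _ hm, Φ.right_inv (hmaps _ hbV)]
  have hψd : MDifferentiableAt (𝓡 n) (𝓡 k) ψ a := (hψs a).mdifferentiableAt (by simp)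
  rw [heq.mfderiv_eq, mfderiv_comp a hh hψd]
  exact (congrArg (mfderiv (𝓡 k) 𝓘(ℝ, ℂ) h (ψ a)) hτ).trans (map_zero _)

/-- The derivative of a function in `ringR` along an edge vector field vanishes on the boundary. -/
lemma dirDeriv_eq_zero_of_mem_boundary (hφ : IsBoundaryFibration (n := n) q emb φ)
    {f : M → ℂ} (hf : f ∈ ringR (n := n) emb φ) {X : ∀ p : M, TangentSpace (𝓡∂ (n + 1)) p}
    (hX : IsEdgeField q emb φ X) {p : M} (hp : p ∈ (𝓡∂ (n + 1)).boundary M) :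
    dirDeriv f X p = 0 := by
  rw [← hφ.iUnion_range] at hp
  obtain ⟨i, a, rfl⟩ := mem_iUnion.1 hp
  obtain ⟨τ, hτ, hτX⟩ := hX.2 i a
  have hd : MDifferentiableAt (𝓡∂ (n + 1)) 𝓘(ℝ, ℂ) f (emb i a) :=
    (hf.1 _).mdifferentiableAt (by simp)
  have he : MDifferentiableAt (𝓡 n) (𝓡∂ (n + 1)) (emb i) a :=
    (hφ.contMDiff_emb i a).mdifferentiableAt (by simp)
  have h := mfderiv_eq_zero_of_constant_on_fibers (hφ.isSmoothFibration i)
    (hf.1.comp (hφ.contMDiff_emb i)) (hf.2 i) a τ hτ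
  rw [mfderiv_comp a hd he] at h
  rw [dirDeriv, ← hτX]
  exact h

variable {FE : Type*} [NormedAddCommGroup FE] [NormedSpace ℂ FE]
  {E : M → Type*} [TopologicalSpace (TotalSpace FE E)] [∀ p, NormedAddCommGroup (E p)]
  [∀ p, InnerProductSpace ℂ (E p)] [FiberBundle FE E] [VectorBundle ℂ FE E]
  [VectorBundle ℝ FE E] [ContMDiffVectorBundle ∞ FE E (𝓡∂ (n + 1))]
  {FF : Type*} [NormedAddCommGroup FF] [NormedSpace ℂ FF]
  {F : M → Type*} [TopologicalSpace (TotalSpace FF F)] [∀ p, NormedAddCommGroup (F p)]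
  [∀ p, InnerProductSpace ℂ (F p)] [FiberBundle FF F] [VectorBundle ℂ FF F]
  [VectorBundle ℝ FF F] [ContMDiffVectorBundle ∞ FF F (𝓡∂ (n + 1))]

/-- The product of a smooth section with a smooth function. -/
def smulSection {f : M → ℂ} (hf : ContMDiff (𝓡∂ (n + 1)) 𝓘(ℝ, ℂ) ∞ f)
    (s : smoothSections n FE E) : smoothSections n FE E :=
  ⟨f • (s : ∀ p, E p), smul_mem_smoothSections hf s.2⟩

/-- In the Leibniz rule the zeroth-order part `C` commutes with `f`; only the terms with `X_j`
acting on `f` survive in the commutator. -/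
lemma HasLocalForm.localRep_smulSection {P : smoothSections n FE E →ₗ[ℂ] smoothSections n FF F}
    {p₀ : M} {U : Set M} (hU : U ⊆ (trivializationAt FE E p₀).baseSet) {κ : Type} [Fintype κ]
    {X : κ → ∀ p : M, TangentSpace (𝓡∂ (n + 1)) p} {B : κ → M → FE →L[ℂ] FF} {C : M → FE →L[ℂ] FF}
    (hP : HasLocalForm P p₀ U X B C) {f : M → ℂ} (hf : ContMDiff (𝓡∂ (n + 1)) 𝓘(ℝ, ℂ) ∞ f)
    (s : smoothSections n FE E) {p : M} (hp : p ∈ U) :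
    localRep FF p₀ (P (smulSection hf s) : ∀ p, F p) p =
      f p • localRep FF p₀ (P s : ∀ p, F p) p +
        (∑ j, dirDeriv f (X j) p • B j p) (localRep FE p₀ (s : ∀ p, E p) p) := by
  have hpb := hU hp
  have hnh := (trivializationAt FE E p₀).open_baseSet.mem_nhds hpb
  have heq : localRep FE p₀ (smulSection hf s : ∀ p, E p) =ᶠ[𝓝 p]
      fun y => f y • localRep FE p₀ (s : ∀ p, E p) y := by
    filter_upwards [hnh] with y hy
    exact localRep_smul p₀ f _ hy
  have hfd : MDifferentiableAt (𝓡∂ (n + 1)) 𝓘(ℝ, ℂ) f p := (hf p).mdifferentiableAt (by simp)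
  have hsd : MDifferentiableAt (𝓡∂ (n + 1)) 𝓘(ℝ, FE) (localRep FE p₀ (s : ∀ p, E p)) p :=
    ((contMDiffOn_localRep s.2 p₀).contMDiffAt hnh).mdifferentiableAt (by simp)
  have hderiv : ∀ j, B j p (dirDeriv (localRep FE p₀ (smulSection hf s : ∀ p, E p)) (X j) p) =
      f p • B j p (dirDeriv (localRep FE p₀ (s : ∀ p, E p)) (X j) p) +
        dirDeriv f (X j) p • B j p (localRep FE p₀ (s : ∀ p, E p) p) := by
    intro j
    rw [dirDeriv_congr heq, dirDeriv_complex_smul hfd hsd, map_add, map_smul, map_smul]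
  have hform : ∀ s : smoothSections n FE E, localRep FF p₀ (P s : ∀ p, F p) p =
      ∑ j, B j p (dirDeriv (localRep FE p₀ (s : ∀ p, E p)) (X j) p) +
        C p (localRep FE p₀ (s : ∀ p, E p) p) := fun s => hP.2.2 s p hp
  rw [hform, hform, heq.eq_of_nhds, smul_add, Finset.smul_sum,
    Finset.sum_congr rfl fun j _ => hderiv j, Finset.sum_add_distrib, map_smul]
  simp only [FunLike.coe_sum, Finset.sum_apply, smul_apply]
  abel

/-- The commutator of an edge operator with a function in `ringR` is a smooth bundle homomorphism
which is bounded by a multiple of the defining function. -/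
lemma exists_commutator [T2Space M] (hφ : IsBoundaryFibration (n := n) q emb φ)
    {x : M → ℝ} (hx : IsDefiningFunction (n := n) x)
    {P : smoothSections n FE E →ₗ[ℂ] smoothSections n FF F} (hP : IsEdgeOperator q emb φ P)
    {f : M → ℂ} (hf : f ∈ ringR (n := n) emb φ) :
    ∃ T : ∀ p, E p →ₗ[ℂ] F p,
      (∀ (s : smoothSections n FE E) p, (P (smulSection hf.1 s) : ∀ p, F p) p =
        f p • (P s : ∀ p, F p) p + T p ((s : ∀ p, E p) p)) ∧
      ∀ p₀, ∃ (U : Set M) (m : M → FE →L[ℂ] FF) (C : ℝ), IsLocalMatrix (n := n) T p₀ U m ∧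
        ∀ᶠ p in 𝓝 p₀, ‖m p‖ ≤ C * x p := by
  choose U hUo hpU hUb k X B C hX hloc using hP
  let m : ∀ p₀ : M, M → FE →L[ℂ] FF := fun p₀ p => ∑ j, dirDeriv f (X p₀ j) p • B p₀ j p
  -- At each point `T` is built from the local form chosen around that same point. Compatibility of
  -- the different choices follows below from the commutator identity.
  let T : ∀ p, E p →ₗ[ℂ] F p := fun p => (trivializationAt FF F p).symmₗ ℂ p ∘ₗ
    (m p p).toLinearMap ∘ₗ (trivializationAt FE E p).linearMapAt ℂ p
  have hm : ∀ p₀ (s : smoothSections n FE E), ∀ p ∈ U p₀,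
      localRep FF p₀ (P (smulSection hf.1 s) : ∀ p, F p) p =
      f p • localRep FF p₀ (P s : ∀ p, F p) p + m p₀ p (localRep FE p₀ (s : ∀ p, E p) p) :=
    fun p₀ s p hp => (hloc p₀).localRep_smulSection (fun y hy => (hUb p₀ hy).1) hf.1 s hp
  have hT : ∀ (s : smoothSections n FE E) p, (P (smulSection hf.1 s) : ∀ p, F p) p =
        f p • (P s : ∀ p, F p) p + T p ((s : ∀ p, E p) p) := by
    intro s p
    have hb := hUb p (hpU p)
    rw [← symm_localRep (F := FF) p (P (smulSection hf.1 s) : ∀ p, F p) hb.2, hm p s p (hpU p)]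
    simp only [T, LinearMap.comp_apply, ContinuousLinearMap.coe_coe]
    rw [Trivialization.coe_linearMapAt_of_mem _ hb.1,
      ← (trivializationAt FF F p).coe_symmₗ (R := ℂ) hb.2, map_add, map_smul,
      (trivializationAt FF F p).coe_symmₗ (R := ℂ) hb.2, symm_localRep _ _ hb.2]
    rfl
  refine ⟨T, hT, fun p₀ => ?_⟩
  have hU : U p₀ ∈ 𝓝 p₀ := (hUo p₀).mem_nhds (hpU p₀)
  have hBc : ∀ j, ∀ᶠ p in 𝓝 p₀, ‖B p₀ j p‖ ≤ ‖B p₀ j p₀‖ + 1 := fun j =>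
    ((((hloc p₀).1 j).contMDiffAt hU).continuousAt.norm.eventually_lt_const
      (lt_add_one _)).mono fun _ h => h.le
  -- This is where membership of `f` in the ring enters: `X_j f` vanishes on the boundary and is
  -- therefore `O(x)`.
  choose c hc hc' using fun j => exists_norm_le_mul_definingFunction hx
    (contMDiff_dirDeriv hf.1 (hX p₀ j).1)
    (fun p hp => dirDeriv_eq_zero_of_mem_boundary hφ hf (hX p₀ j) hp) p₀
  refine ⟨U p₀, m p₀, ∑ j, c j * (‖B p₀ j p₀‖ + 1), ⟨hU, hUo p₀, hUb p₀, ?_, ?_⟩, ?_⟩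
  · intro p hp
    have hpn := (hUo p₀).mem_nhds hp
    exact (ContMDiffAt.sum fun j _ => contMDiffAt_complex_smul
      (contMDiff_dirDeriv hf.1 (hX p₀ j).1 p)
      (((hloc p₀).1 j).contMDiffAt hpn)).contMDiffWithinAt
  -- Extend `v` to a smooth section. The commutator identity computed through `T` and through the
  -- local form around `p₀` then forces the matrix of `T` to be `m p₀`.
  · intro p hp v
    obtain ⟨s, rfl⟩ := exists_smoothSection_eq (n := n) (F := FE) p v
    have hb := (hUb p₀ hp).2
    have h1 := hm p₀ s p hp
    have h2 : localRep FF p₀ (P (smulSection hf.1 s) : ∀ p, F p) p =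
        f p • localRep FF p₀ (P s : ∀ p, F p) p +
          (trivializationAt FF F p₀ ⟨p, T p ((s : ∀ p, E p) p)⟩).2 := by
      rw [localRep, hT, ((trivializationAt FF F p₀).linear ℂ hb).map_add,
        ((trivializationAt FF F p₀).linear ℂ hb).map_smul]
      rfl
    exact add_left_cancel (h2.symm.trans h1)
  · filter_upwards [Filter.eventually_all.2 hBc, Filter.eventually_all.2 hc'] with p h1 h2
    rw [Finset.sum_mul]
    refine (norm_sum_le _ _).trans (Finset.sum_le_sum fun j _ => ?_)
    rw [norm_smul]
    calc _ ≤ (c j * x p) * (‖B p₀ j p₀‖ + 1) :=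
          mul_le_mul (h2 j) (h1 j) (norm_nonneg _) ((norm_nonneg _).trans (h2 j))
      _ = _ := by ring

end Edge

/-! ### Finiteness of the densities, and local measurability. -/

section Measure

variable {n : ℕ} {M : Type*} [TopologicalSpace M] [ChartedSpace (EuclideanHalfSpace (n + 1)) M]
  [IsManifold (𝓡∂ (n + 1)) ∞ M] [MeasurableSpace M] [BorelSpace M]

/-- Near `p₀` the density is bounded and the chart image lies in a unit ball of finite Lebesgue
measure. -/
lemma IsSmoothDensity.exists_measure_lt_top {μ : Measure M} (hμ : IsSmoothDensity (n := n) μ)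
    (p₀ : M) : ∃ U ∈ 𝓝 p₀, μ U < ⊤ := by
  obtain ⟨ρ, hρ, -, hμρ⟩ := hμ p₀
  set e := extChartAt (𝓡∂ (n + 1)) p₀ with he
  have hsrc : e.source ∈ 𝓝 p₀ := extChartAt_source_mem_nhds p₀
  have h1 : ∀ᶠ p in 𝓝 p₀, ρ (e p) < ρ (e p₀) + 1 := by
    have hc : ContinuousOn (ρ ∘ e) e.source :=
      hρ.continuousOn.comp (continuousOn_extChartAt p₀) e.mapsTo
    exact (hc.continuousAt hsrc).eventually_lt_const (lt_add_one _)
  have h2 : ∀ᶠ p in 𝓝 p₀, e p ∈ Metric.ball (e p₀) 1 :=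
    (continuousAt_extChartAt p₀).eventually (Metric.ball_mem_nhds _ one_pos)
  obtain ⟨U, hUsub, hUo, hpU⟩ := mem_nhds_iff.1 (Filter.inter_mem hsrc (Filter.inter_mem h1 h2))
  refine ⟨U, hUo.mem_nhds hpU, ?_⟩
  have hUsrc : U ⊆ e.source := fun p hp => (hUsub hp).1
  rw [hμρ U hUo.measurableSet hUsrc]
  -- The image is the preimage of the open set `U` under the continuous inverse chart, hence
  -- relatively open in the measurable chart target.
  have himage : MeasurableSet (e '' U) := by
    obtain ⟨O, hO, hOU⟩ := continuousOn_iff'.1 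
      (continuousOn_extChartAt_symm (I := 𝓡∂ (n + 1)) p₀) U hUo
    have htar : MeasurableSet e.target := by
      rw [he, extChartAt_target]
      exact (((chartAt _ p₀).open_target.preimage (𝓡∂ (n + 1)).continuous_symm).measurableSet).inter
        (𝓡∂ (n + 1)).isClosed_range.measurableSet
    rw [e.image_eq_target_inter_inv_preimage hUsrc, inter_comm, hOU]
    exact hO.measurableSet.inter htar
  calc ∫⁻ v in e '' U, ENNReal.ofReal (ρ v)
      ≤ ∫⁻ _ in e '' U, ENNReal.ofReal (ρ (e p₀) + 1) := by
        refine setLIntegral_mono' himage ?_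
        rintro _ ⟨p, hp, rfl⟩
        exact ENNReal.ofReal_le_ofReal (hUsub hp).2.1.le
    _ = ENNReal.ofReal (ρ (e p₀) + 1) * volume (e '' U) := by simp
    _ ≤ ENNReal.ofReal (ρ (e p₀) + 1) * volume (Metric.ball (e p₀) 1) := by
        gcongr
        rintro _ ⟨p, hp, rfl⟩
        exact (hUsub hp).2.2
    _ < ⊤ := ENNReal.mul_lt_top ENNReal.ofReal_lt_top measure_ball_lt_top

lemma IsSmoothDensity.isFiniteMeasure [CompactSpace M] {μ : Measure M}
    (hμ : IsSmoothDensity (n := n) μ) : IsFiniteMeasure μ := by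
  refine ⟨isCompact_univ.measure_lt_top_of_nhdsWithin fun p _ => ?_⟩
  obtain ⟨U, hU, hμU⟩ := hμ.exists_measure_lt_top p
  exact ⟨U, mem_nhdsWithin_of_mem_nhds hU, hμU⟩

/-- On a compact subset of the interior `x` has a positive lower bound, so `x⁻¹` is bounded there,
while the smooth density is finite. -/
lemma IsBDensity.measure_lt_top [CompactSpace M] {x : M → ℝ} (hx : IsDefiningFunction (n := n) x)
    {mb : Measure M} (hmb : IsBDensity (n := n) x mb) {K : Set M} (hK : IsCompact K)
    (hKi : K ⊆ (𝓡∂ (n + 1)).interior M) : mb K < ⊤ := by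
  obtain ⟨μ, hμ, rfl⟩ := hmb
  have := hμ.isFiniteMeasure
  obtain ⟨δ, hδ, hKδ⟩ : ∃ δ, 0 < δ ∧ ∀ p ∈ K, δ ≤ x p := by
    rcases K.eq_empty_or_nonempty with rfl | hne
    · exact ⟨1, one_pos, by simp⟩
    · obtain ⟨p, hp, hmin⟩ := hK.exists_isMinOn hne hx.contMDiff.continuous.continuousOn
      exact ⟨x p, hx.pos p (hKi hp), fun y hy => hmin hy⟩
  have hset : MeasurableSet {p | δ ≤ x p} :=
    (isClosed_le continuous_const hx.contMDiff.continuous).measurableSet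
  calc _ ≤ (μ.withDensity fun p => ENNReal.ofReal (x p)⁻¹) {p | δ ≤ x p} := measure_mono hKδ
    _ = ∫⁻ p in {p | δ ≤ x p}, ENNReal.ofReal (x p)⁻¹ ∂μ := withDensity_apply _ hset
    _ ≤ ∫⁻ _ in {p | δ ≤ x p}, ENNReal.ofReal δ⁻¹ ∂μ := by
        refine setLIntegral_mono' hset fun p hp => ENNReal.ofReal_le_ofReal ?_
        exact inv_anti₀ hδ hp
    _ < ⊤ := by
        rw [setLIntegral_const]
        exact ENNReal.mul_lt_top ENNReal.ofReal_lt_top (MeasureTheory.measure_lt_top _ _)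

/-- On a compact space, almost everywhere strong measurability is a local property. -/
lemma aestronglyMeasurable_of_forall_nhds [CompactSpace M] {G : Type*} [TopologicalSpace G]
    [TopologicalSpace.PseudoMetrizableSpace G] {f : M → G} {ν : Measure M}
    (h : ∀ p₀, ∃ U ∈ 𝓝 p₀, AEStronglyMeasurable f (ν.restrict U)) : AEStronglyMeasurable f ν := by
  have := isCompact_univ.induction_on (X := M)
    (p := fun S => AEStronglyMeasurable f (ν.restrict S)) (by simp)
    (fun S T hST hT => hT.mono_measure (Measure.restrict_mono_set _ hST))
    (fun S T hS hT => aestronglyMeasurable_union_iff.2 ⟨hS, hT⟩)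
    (fun p₀ _ => by
      obtain ⟨U, hU, hfU⟩ := h p₀
      exact ⟨U, mem_nhdsWithin_of_mem_nhds hU, hfU⟩)
  simpa using this

end Measure

/-! ### The weighted space of square integrable sections and its pairing. -/

section L2

variable {n : ℕ} {M : Type*} [TopologicalSpace M] [ChartedSpace (EuclideanHalfSpace (n + 1)) M]
  [IsManifold (𝓡∂ (n + 1)) ∞ M] [MeasurableSpace M] [BorelSpace M] [CompactSpace M]
  [SecondCountableTopology M]
  {FE : Type*} [NormedAddCommGroup FE] [NormedSpace ℂ FE]
  {E : M → Type*} [TopologicalSpace (TotalSpace FE E)] [∀ p, NormedAddCommGroup (E p)]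
  [∀ p, InnerProductSpace ℂ (E p)] [FiberBundle FE E] [VectorBundle ℂ FE E]
  {FF : Type*} [NormedAddCommGroup FF] [NormedSpace ℂ FF]
  {F : M → Type*} [TopologicalSpace (TotalSpace FF F)] [∀ p, NormedAddCommGroup (F p)]
  [∀ p, InnerProductSpace ℂ (F p)] [FiberBundle FF F] [VectorBundle ℂ FF F]
  {x : M → ℝ} {mb : Measure M} {γ : ℝ}

variable (FE) in
/-- The section `s` is measurable, up to a null set. -/
def IsAEMeasurableSection (mb : Measure M) (s : ∀ p, E p) : Prop :=
  ∀ p₀ : M, AEStronglyMeasurable (localRep FE p₀ s)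
    (mb.restrict (trivializationAt FE E p₀).baseSet)

lemma measurableSet_baseSet (p₀ : M) : MeasurableSet (trivializationAt FE E p₀).baseSet :=
  (trivializationAt FE E p₀).open_baseSet.measurableSet

lemma IsAEMeasurableSection.add {s t : ∀ p, E p} (hs : IsAEMeasurableSection FE mb s)
    (ht : IsAEMeasurableSection FE mb t) : IsAEMeasurableSection FE mb (s + t) := fun p₀ => by
  refine ((hs p₀).add (ht p₀)).congr ?_
  filter_upwards [ae_restrict_mem (measurableSet_baseSet p₀)] with p hp
  exact (localRep_add p₀ s t hp).symm

lemma IsAEMeasurableSection.smul {s : ∀ p, E p} {f : M → ℂ} (hf : Measurable f)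
    (hs : IsAEMeasurableSection FE mb s) : IsAEMeasurableSection FE mb (f • s) := fun p₀ => by
  refine (hf.aestronglyMeasurable.smul (hs p₀)).congr ?_
  filter_upwards [ae_restrict_mem (measurableSet_baseSet p₀)] with p hp
  exact (localRep_smul p₀ f s hp).symm

lemma isAEMeasurableSection_of_mem_smoothSections [VectorBundle ℝ FE E]
    [ContMDiffVectorBundle ∞ FE E (𝓡∂ (n + 1))] {s : ∀ p, E p} (hs : s ∈ smoothSections n FE E) :
    IsAEMeasurableSection FE mb s := fun p₀ =>
  (contMDiffOn_localRep hs p₀).continuousOn.aestronglyMeasurable (measurableSet_baseSet p₀)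

/-- Around `p₁` the image is the local matrix applied to the representative of `s`; a continuous
coordinate change carries it to the trivialization around `p₀`. Compactness reduces measurability to
such neighbourhoods. -/
lemma IsAEMeasurableSection.hom [FiniteDimensional ℂ FE] {T : ∀ p, E p →ₗ[ℂ] F p}
    (hT : ∀ p₀, ∃ (U : Set M) (m : M → FE →L[ℂ] FF), IsLocalMatrix (n := n) T p₀ U m)
    {s : ∀ p, E p} (hs : IsAEMeasurableSection FE mb s) :
    IsAEMeasurableSection FF mb (fun p => T p (s p)) := by
  intro p₀
  refine aestronglyMeasurable_of_forall_nhds fun p₁ => ?_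
  obtain ⟨U, m, hU, hUo, hUb, hm, hTm⟩ := hT p₁
  refine ⟨U, hU, ?_⟩
  rw [Measure.restrict_restrict hUo.measurableSet]
  have hmeas : MeasurableSet (U ∩ (trivializationAt FF F p₀).baseSet) :=
    hUo.measurableSet.inter (measurableSet_baseSet p₀)
  have hc : ContinuousOn (fun p => ((trivializationAt FF F p₁).coordChangeL ℂ
      (trivializationAt FF F p₀) p : FF →L[ℂ] FF)) (U ∩ (trivializationAt FF F p₀).baseSet) :=
    (continuousOn_coordChange ℂ (trivializationAt FF F p₁)
      (trivializationAt FF F p₀)).mono fun p hp => ⟨(hUb hp.1).2, hp.2⟩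
  have h1 := hc.aestronglyMeasurable (μ := mb) hmeas
  have h2 := (hm.continuousOn.mono (inter_subset_left
    (t := (trivializationAt FF F p₀).baseSet))).aestronglyMeasurable (μ := mb) hmeas
  have h3 : AEStronglyMeasurable (localRep FE p₁ s)
      (mb.restrict (U ∩ (trivializationAt FF F p₀).baseSet)) :=
    (hs p₁).mono_measure (Measure.restrict_mono_set _ fun p hp => (hUb hp.1).1)
  have h4 := isBoundedBilinearMap_apply.continuous.comp_aestronglyMeasurable (h2.prodMk h3)
  have h5 := isBoundedBilinearMap_apply.continuous.comp_aestronglyMeasurable (h1.prodMk h4)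
  refine h5.congr ?_
  filter_upwards [ae_restrict_mem hmeas] with p hp
  have hb := hUb hp.1
  change (trivializationAt FF F p₁).coordChangeL ℂ (trivializationAt FF F p₀) p
    (m p (trivializationAt FE E p₁ ⟨p, s p⟩).2) = (trivializationAt FF F p₀ ⟨p, T p (s p)⟩).2
  rw [← hTm p hp.1, Trivialization.coordChangeL_apply _ _ ⟨hb.2, hp.2⟩,
    (trivializationAt FF F p₁).symm_apply_apply_mk hb.2]

lemma IsAEMeasurableSection.inner [FiniteDimensional ℂ FE] (hE : IsSmoothHermitian n FE E)
    {s t : ∀ p, E p} (hs : IsAEMeasurableSection FE mb s) (ht : IsAEMeasurableSection FE mb t) :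
    AEStronglyMeasurable (fun p => inner ℂ (s p) (t p)) mb := by
  refine aestronglyMeasurable_of_forall_nhds fun p₀ => ?_
  refine ⟨(trivializationAt FE E p₀).baseSet, (trivializationAt FE E p₀).open_baseSet.mem_nhds
    (FiberBundle.mem_baseSet_trivializationAt' p₀), ?_⟩
  have hcoord : ∀ i, Continuous fun a : FE => (Module.finBasis ℂ FE).repr a i := fun i =>
    (LinearMap.toContinuousLinearMap ((Module.finBasis ℂ FE).coord i)).continuous
  have hg := (contMDiffOn_gram hE p₀).continuousOn.aestronglyMeasurable (μ := mb)
    (measurableSet_baseSet p₀)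
  have hgt := isBoundedBilinearMap_apply.continuous.comp_aestronglyMeasurable (hg.prodMk (ht p₀))
  have h : AEStronglyMeasurable (fun p => ∑ i,
      star ((Module.finBasis ℂ FE).repr (localRep FE p₀ s p) i) *
        (Module.finBasis ℂ FE).repr (gram FE E p₀ p (localRep FE p₀ t p)) i)
      (mb.restrict (trivializationAt FE E p₀).baseSet) := by
    refine Finset.aestronglyMeasurable_fun_sum _ fun i _ => ?_
    exact (continuous_star.comp_aestronglyMeasurable
      ((hcoord i).comp_aestronglyMeasurable (hs p₀))).mul ((hcoord i).comp_aestronglyMeasurable hgt)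
  refine h.congr ?_
  filter_upwards [ae_restrict_mem (measurableSet_baseSet p₀)] with p hp
  exact (inner_eq_sum_localRep hp s t).symm

lemma IsAEMeasurableSection.aemeasurable_normSq [FiniteDimensional ℂ FE]
    (hE : IsSmoothHermitian n FE E) (hx : Measurable x) {s : ∀ p, E p}
    (hs : IsAEMeasurableSection FE mb s) :
    AEMeasurable (fun p => ENNReal.ofReal (‖s p‖ ^ 2 * x p ^ (2 * γ))) mb := by
  have h := Complex.continuous_re.comp_aestronglyMeasurable (hs.inner hE hs)
  refine (AEMeasurable.mul (h.aemeasurable.congr ?_) (hx.pow_const _).aemeasurable).ennreal_ofReal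
  exact Filter.Eventually.of_forall fun p => inner_self_eq_norm_sq (𝕜 := ℂ) (s p)

lemma normSq_add_le [FiniteDimensional ℂ FE] (hE : IsSmoothHermitian n FE E)
    (hx : Measurable x) (hx0 : ∀ p, 0 ≤ x p) {s t : ∀ p, E p} (hs : IsAEMeasurableSection FE mb s) :
    normSq x mb γ (s + t) ≤ 2 * normSq x mb γ s + 2 * normSq x mb γ t := by
  unfold normSq
  rw [← lintegral_const_mul' _ _ (by simp), ← lintegral_const_mul' _ _ (by simp),
    ← lintegral_add_left' ((hs.aemeasurable_normSq hE hx).const_mul 2)]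
  refine lintegral_mono fun p => ?_
  have h2 : (2 : ℝ≥0∞) = ENNReal.ofReal 2 := by simp
  have hw : 0 ≤ x p ^ (2 * γ) := Real.rpow_nonneg (hx0 p) _
  rw [h2, ← ENNReal.ofReal_mul zero_le_two, ← ENNReal.ofReal_mul zero_le_two,
    ← ENNReal.ofReal_add (by positivity) (by positivity)]
  refine ENNReal.ofReal_le_ofReal ?_
  have h3 : ‖(s + t) p‖ ^ 2 ≤ 2 * ‖s p‖ ^ 2 + 2 * ‖t p‖ ^ 2 := by
    have h4 : ‖(s + t) p‖ ≤ ‖s p‖ + ‖t p‖ := norm_add_le _ _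
    nlinarith [norm_nonneg ((s + t) p), sq_nonneg (‖s p‖ - ‖t p‖)]
  calc _ ≤ (2 * ‖s p‖ ^ 2 + 2 * ‖t p‖ ^ 2) * x p ^ (2 * γ) := by gcongr
    _ = _ := by ring

lemma normSq_le_mul (hx0 : ∀ p, 0 ≤ x p) {s : ∀ p, E p} {t : ∀ p, F p} {C : ℝ}
    (h : ∀ p, ‖s p‖ ≤ C * ‖t p‖) :
    normSq x mb γ s ≤ ENNReal.ofReal (C ^ 2) * normSq x mb γ t := by
  unfold normSq
  rw [← lintegral_const_mul' _ _ (by simp)]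
  refine lintegral_mono fun p => ?_
  rw [← ENNReal.ofReal_mul (by positivity)]
  refine ENNReal.ofReal_le_ofReal ?_
  have hw : 0 ≤ x p ^ (2 * γ) := Real.rpow_nonneg (hx0 p) _
  calc _ ≤ (C * ‖t p‖) ^ 2 * x p ^ (2 * γ) := by
        gcongr
        exact h p
    _ = _ := by ring

lemma IsL2.add [FiniteDimensional ℂ FE] (hE : IsSmoothHermitian n FE E) (hx : Measurable x)
    (hx0 : ∀ p, 0 ≤ x p) {s t : ∀ p, E p} (hs : IsL2 FE x mb γ s) (ht : IsL2 FE x mb γ t) :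
    IsL2 FE x mb γ (s + t) :=
  ⟨IsAEMeasurableSection.add hs.1 ht.1, (normSq_add_le hE hx hx0 hs.1).trans_lt
    (ENNReal.add_lt_top.2 ⟨ENNReal.mul_lt_top (by simp) hs.2, ENNReal.mul_lt_top (by simp) ht.2⟩)⟩

lemma IsL2.zero : IsL2 FE x mb γ (0 : ∀ p, E p) := by
  refine ⟨fun p₀ => ?_, by simp [normSq]⟩
  refine (aestronglyMeasurable_const (b := (0 : FE))).congr ?_
  filter_upwards [ae_restrict_mem (measurableSet_baseSet p₀)] with p hp
  exact ((trivializationAt FE E p₀).linear ℂ hp).map_zero.symm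

lemma IsL2.smul (hx0 : ∀ p, 0 ≤ x p) {f : M → ℂ} (hf : Continuous f) {s : ∀ p, E p}
    (hs : IsL2 FE x mb γ s) : IsL2 FE x mb γ (f • s) := by
  obtain ⟨C, hC⟩ := isCompact_univ.exists_bound_of_continuousOn hf.continuousOn
  refine ⟨IsAEMeasurableSection.smul hf.measurable hs.1,
    (normSq_le_mul (t := s) (C := C) hx0 fun p => ?_).trans_lt
      (ENNReal.mul_lt_top ENNReal.ofReal_lt_top hs.2)⟩
  change ‖f p • s p‖ ≤ _
  rw [norm_smul]
  gcongr
  exact hC p (mem_univ p)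

lemma IsL2.neg (hx0 : ∀ p, 0 ≤ x p) {s : ∀ p, E p} (hs : IsL2 FE x mb γ s) :
    IsL2 FE x mb γ (-s) := by
  have h := hs.smul hx0 (continuous_const (y := (-1 : ℂ)))
  rwa [show (fun _ : M => (-1 : ℂ)) • s = -s by ext p; simp] at h

lemma IsL2.sub [FiniteDimensional ℂ FE] (hE : IsSmoothHermitian n FE E) (hx : Measurable x)
    (hx0 : ∀ p, 0 ≤ x p) {s t : ∀ p, E p} (hs : IsL2 FE x mb γ s) (ht : IsL2 FE x mb γ t) :
    IsL2 FE x mb γ (s - t) := by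
  rw [sub_eq_add_neg]
  exact hs.add hE hx hx0 (ht.neg hx0)

/-- Smooth sections with compact support in the interior are of class `L²`. -/
lemma isL2_of_supportedInInterior [FiniteDimensional ℂ FE] [VectorBundle ℝ FE E]
    [ContMDiffVectorBundle ∞ FE E (𝓡∂ (n + 1))] (hE : IsSmoothHermitian n FE E)
    (hx : IsDefiningFunction (n := n) x) (hmb : IsBDensity (n := n) x mb) {s : ∀ p, E p}
    (hs : s ∈ smoothSections n FE E) (hs' : SupportedInInterior n s) : IsL2 FE x mb γ s := by
  refine ⟨isAEMeasurableSection_of_mem_smoothSections hs, ?_⟩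
  set K := closure {p | s p ≠ 0} with hK
  have hKc : IsCompact K := isClosed_closure.isCompact
  have hcont : ContinuousOn (fun p => ‖s p‖ ^ 2 * x p ^ (2 * γ)) K := by
    refine ContinuousOn.mul (Continuous.continuousOn ?_) ?_
    · have h1 : Continuous fun p => (inner ℂ (s p) (s p) : ℂ) := by
        refine continuous_iff_continuousAt.2 fun p => ?_
        have hp := FiberBundle.mem_baseSet_trivializationAt' (F := FE) (E := E) p
        have hsp := (contMDiffAt_section_iff_localRep hp).1 (hs p)
        exact (contMDiffAt_inner hE hp hsp hsp).continuousAt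
      refine (Complex.continuous_re.comp h1).congr fun p => ?_
      exact inner_self_eq_norm_sq (𝕜 := ℂ) (s p)
    · exact hx.contMDiff.continuous.continuousOn.rpow_const
        fun p hp => Or.inl (hx.pos p (hs' hp)).ne'
  obtain ⟨C, hC⟩ := hKc.exists_bound_of_continuousOn hcont
  calc normSq x mb γ s ≤ ∫⁻ p, K.indicator (fun _ => ENNReal.ofReal C) p ∂mb := by
        refine lintegral_mono fun p => ?_
        by_cases hp : p ∈ K
        · rw [indicator_of_mem hp]
          exact ENNReal.ofReal_le_ofReal ((le_abs_self _).trans (hC p hp))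
        · have : s p = 0 := by
            by_contra h0
            exact hp (subset_closure h0)
          simp [this]
    _ = ENNReal.ofReal C * mb K := lintegral_indicator_const isClosed_closure.measurableSet _
    _ < ⊤ := ENNReal.mul_lt_top ENNReal.ofReal_lt_top (hmb.measure_lt_top hx hKc hs')

lemma integrable_pairing [FiniteDimensional ℂ FE] (hE : IsSmoothHermitian n FE E)
    (hx : Measurable x) (hx0 : ∀ p, 0 ≤ x p) {s t : ∀ p, E p} (hs : IsL2 FE x mb γ s)
    (ht : IsL2 FE x mb γ t) :
    Integrable (fun p => inner ℂ (t p) (s p) * ((x p ^ (2 * γ) : ℝ) : ℂ)) mb := by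
  refine ⟨(IsAEMeasurableSection.inner hE ht.1 hs.1).mul
    (Complex.measurable_ofReal.comp (hx.pow_const _)).aestronglyMeasurable, ?_⟩
  have hlt : normSq x mb γ t + normSq x mb γ s < ⊤ := ENNReal.add_lt_top.2 ⟨ht.2, hs.2⟩
  refine lt_of_le_of_lt ?_ hlt
  unfold normSq
  rw [← lintegral_add_left' (IsAEMeasurableSection.aemeasurable_normSq hE hx ht.1)]
  refine lintegral_mono fun p => ?_
  have hw : 0 ≤ x p ^ (2 * γ) := Real.rpow_nonneg (hx0 p) _
  rw [← ENNReal.ofReal_add (by positivity) (by positivity), ← ofReal_norm]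
  refine ENNReal.ofReal_le_ofReal ?_
  rw [norm_mul, Complex.norm_real, Real.norm_of_nonneg hw, ← add_mul]
  gcongr
  have h1 := norm_inner_le_norm (𝕜 := ℂ) (t p) (s p)
  -- After Cauchy–Schwarz, `‖t‖ ‖s‖ ≤ ‖t‖² + ‖s‖²`: the integrand is dominated by the two
  -- square-norm densities.
  nlinarith [sq_nonneg (‖t p‖ - ‖s p‖), norm_nonneg (t p), norm_nonneg (s p),
    mul_nonneg (norm_nonneg (t p)) (norm_nonneg (s p))]

lemma pairing_add_left [FiniteDimensional ℂ FE] (hE : IsSmoothHermitian n FE E)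
    (hx : Measurable x) (hx0 : ∀ p, 0 ≤ x p) {s s' t : ∀ p, E p} (hs : IsL2 FE x mb γ s)
    (hs' : IsL2 FE x mb γ s') (ht : IsL2 FE x mb γ t) :
    pairing x mb γ (s + s') t = pairing x mb γ s t + pairing x mb γ s' t := by
  unfold pairing
  rw [← integral_add (integrable_pairing hE hx hx0 hs ht) (integrable_pairing hE hx hx0 hs' ht)]
  refine integral_congr_ae (Filter.Eventually.of_forall fun p => ?_)
  simp only [Pi.add_apply, inner_add_right, add_mul]

lemma pairing_sub_right [FiniteDimensional ℂ FE] (hE : IsSmoothHermitian n FE E)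
    (hx : Measurable x) (hx0 : ∀ p, 0 ≤ x p) {s t t' : ∀ p, E p} (hs : IsL2 FE x mb γ s)
    (ht : IsL2 FE x mb γ t) (ht' : IsL2 FE x mb γ t') :
    pairing x mb γ s (t - t') = pairing x mb γ s t - pairing x mb γ s t' := by
  unfold pairing
  rw [← integral_sub (integrable_pairing hE hx hx0 hs ht) (integrable_pairing hE hx hx0 hs ht')]
  refine integral_congr_ae (Filter.Eventually.of_forall fun p => ?_)
  simp only [Pi.sub_apply, inner_sub_left, sub_mul]

lemma pairing_smul_left (f : M → ℂ) (s t : ∀ p, E p) :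
    pairing x mb γ (f • s) t = pairing x mb γ s (star f • t) := by
  unfold pairing
  refine integral_congr_ae (Filter.Eventually.of_forall fun p => ?_)
  change inner ℂ (t p) (f p • s p) * _ = inner ℂ (star (f p) • t p) (s p) * _
  rw [inner_smul_right, inner_smul_left]
  simp

lemma pairing_hom {S : ∀ p, E p →ₗ[ℂ] F p} {t : ∀ p, F p} {r : ∀ p, E p}
    (hr : ∀ p v, inner ℂ v (r p) = inner ℂ (S p v) (t p)) (s : ∀ p, E p) :
    pairing x mb γ (fun p => S p (s p)) t = pairing x mb γ s r := by
  unfold pairing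
  refine integral_congr_ae (Filter.Eventually.of_forall fun p => ?_)
  simp only
  rw [← inner_conj_symm, ← hr, inner_conj_symm]

end L2

/-! ### The commutator of a wedge operator and the distributional Leibniz rule. -/

section Modules

variable {n : ℕ} {M : Type*} [TopologicalSpace M] [ChartedSpace (EuclideanHalfSpace (n + 1)) M]
  [IsManifold (𝓡∂ (n + 1)) ∞ M] [MeasurableSpace M] [BorelSpace M] [CompactSpace M]
  [SecondCountableTopology M]
  {FE : Type*} [NormedAddCommGroup FE] [NormedSpace ℂ FE] [FiniteDimensional ℂ FE]
  {E : M → Type*} [TopologicalSpace (TotalSpace FE E)] [∀ p, NormedAddCommGroup (E p)]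
  [∀ p, InnerProductSpace ℂ (E p)] [FiberBundle FE E] [VectorBundle ℂ FE E]
  [VectorBundle ℝ FE E] [ContMDiffVectorBundle ∞ FE E (𝓡∂ (n + 1))]
  {FF : Type*} [NormedAddCommGroup FF] [NormedSpace ℂ FF] [FiniteDimensional ℂ FF]
  {F : M → Type*} [TopologicalSpace (TotalSpace FF F)] [∀ p, NormedAddCommGroup (F p)]
  [∀ p, InnerProductSpace ℂ (F p)] [FiberBundle FF F] [VectorBundle ℂ FF F]
  [VectorBundle ℝ FF F] [ContMDiffVectorBundle ∞ FF F (𝓡∂ (n + 1))]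
  {x : M → ℝ} {mb : Measure M} {γ : ℝ}

lemma contMDiffAt_inv_definingFunction (hx : IsDefiningFunction (n := n) x) {p : M}
    (hp : p ∈ (𝓡∂ (n + 1)).interior M) :
    ContMDiffAt (𝓡∂ (n + 1)) 𝓘(ℝ, ℂ) ∞ (fun p => (x p : ℂ)⁻¹) p := by
  have h1 : ContDiffAt ℝ ∞ (fun r : ℝ => ((r⁻¹ : ℝ) : ℂ)) (x p) :=
    Complex.ofRealCLM.contDiff.contDiffAt.comp (x p) (contDiffAt_inv ℝ (hx.pos p hp).ne')
  refine (h1.comp_contMDiffAt (hx.contMDiff p)).congr_of_eventuallyEq ?_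
  exact Filter.Eventually.of_forall fun y => by simp

/-- Edge operators do not enlarge supports. -/
lemma IsEdgeOperator.supportedInInterior {ι : Type*} {N : ι → Type u} [∀ i, TopologicalSpace (N i)]
    [∀ i, ChartedSpace (EuclideanSpace ℝ (Fin n)) (N i)]
    {q : ι → ℕ} {Y : ι → Type*} [∀ i, TopologicalSpace (Y i)]
    [∀ i, ChartedSpace (EuclideanSpace ℝ (Fin (q i))) (Y i)]
    {emb : ∀ i, N i → M} {φ : ∀ i, N i → Y i}
    {P : smoothSections n FE E →ₗ[ℂ] smoothSections n FF F} (hP : IsEdgeOperator q emb φ P)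
    {s : smoothSections n FE E} (hs : SupportedInInterior n (s : ∀ p, E p)) :
    SupportedInInterior n (P s : ∀ p, F p) := by
  refine (closure_minimal (fun p hp => ?_) isClosed_closure).trans hs
  by_contra hps
  obtain ⟨U, hUo, hpU, hUb, k, X, B, C, -, -, -, hloc⟩ := hP p
  have h0 : localRep FE p (s : ∀ p, E p) =ᶠ[𝓝 p] fun _ => 0 := by
    filter_upwards [isClosed_closure.isOpen_compl.mem_nhds hps, hUo.mem_nhds hpU] with y hy hyU
    have hsy : (s : ∀ p, E p) y = 0 := by
      by_contra h
      exact hy (subset_closure h)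
    rw [localRep, hsy]
    exact ((trivializationAt FE E p).linear ℂ (hUb hyU).1).map_zero
  have hd : ∀ j, dirDeriv (localRep FE p (s : ∀ p, E p)) (X j) p = 0 := by
    intro j
    rw [dirDeriv_congr h0, dirDeriv, mfderiv_const]
    rfl
  have h1 : localRep FF p (P s : ∀ p, F p) p =
      ∑ j, B j p (dirDeriv (localRep FE p (s : ∀ p, E p)) (X j) p) +
        C p (localRep FE p (s : ∀ p, E p) p) := hloc s p hpU
  rw [h0.eq_of_nhds] at h1
  simp only [hd, map_zero, Finset.sum_const_zero, add_zero] at h1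
  refine hp ?_
  rw [← symm_localRep (F := FF) p (P s : ∀ p, F p) (hUb hpU).2, h1,
    ← (trivializationAt FF F p).coe_symmₗ (R := ℂ) (hUb hpU).2, map_zero]

variable (FF) in
/-- The commutator of `A` with multiplication by the smooth function `f` is the bundle homomorphism
`S`, which is bounded, preserves the class `L²`, and has an adjoint that maps smooth sections with
compact support in the interior to such sections. -/
structure IsTameCommutator (x : M → ℝ) (mb : Measure M) (γ : ℝ)
    (A : smoothSections n FE E →ₗ[ℂ] (∀ p, F p)) (f : M → ℂ) (S : ∀ p, E p →ₗ[ℂ] F p) : Prop where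
  contMDiff : ContMDiff (𝓡∂ (n + 1)) 𝓘(ℝ, ℂ) ∞ f
  apply_smul : ∀ s : smoothSections n FE E, A (smulSection contMDiff s) =
    f • A s + fun p => S p ((s : ∀ p, E p) p)
  isL2 : ∀ s : ∀ p, E p, IsL2 FE x mb γ s → IsL2 FF x mb γ (fun p => S p (s p))
  bounded : ∃ C : ℝ, ∀ p (v : E p), ‖S p v‖ ≤ C * ‖v‖
  adjoint : ∀ t : smoothSections n FF F, SupportedInInterior n (t : ∀ p, F p) →
    ∃ r : smoothSections n FE E, SupportedInInterior n (r : ∀ p, E p) ∧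
      ∀ p (v : E p), inner ℂ v ((r : ∀ p, E p) p) = inner ℂ (S p v) ((t : ∀ p, F p) p)

/-- The commutator of a wedge operator with a function in `ringR` is a bounded bundle
homomorphism. -/
lemma exists_isTameCommutator [T2Space M]
    {ι : Type*} {N : ι → Type u} [∀ i, TopologicalSpace (N i)]
    [∀ i, ChartedSpace (EuclideanSpace ℝ (Fin n)) (N i)]
    {q : ι → ℕ} {Y : ι → Type*} [∀ i, TopologicalSpace (Y i)]
    [∀ i, ChartedSpace (EuclideanSpace ℝ (Fin (q i))) (Y i)]
    {emb : ∀ i, N i → M} {φ : ∀ i, N i → Y i} (hφ : IsBoundaryFibration (n := n) q emb φ)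
    (hE : IsSmoothHermitian n FE E) (hF : IsSmoothHermitian n FF F)
    (hx : IsDefiningFunction (n := n) x) {A : smoothSections n FE E →ₗ[ℂ] (∀ p, F p)}
    {P : smoothSections n FE E →ₗ[ℂ] smoothSections n FF F}
    (hP : IsEdgeOperator q emb φ P) (hA : EqInvMul x A P)
    {f : M → ℂ} (hf : f ∈ ringR (n := n) emb φ) :
    ∃ S : ∀ p, E p →ₗ[ℂ] F p, IsTameCommutator FF x mb γ A f S := by
  obtain ⟨T, hTP, hT⟩ := exists_commutator hφ hx hP hf
  have hT' : ∀ p₀, ∃ (U : Set M) (m : M → FE →L[ℂ] FF), IsLocalMatrix (n := n) T p₀ U m :=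
    fun p₀ => by
      obtain ⟨U, m, -, h, -⟩ := hT p₀
      exact ⟨U, m, h⟩
  obtain ⟨C, hC, hCT⟩ := exists_norm_hom_le hE hF hx.nonneg T hT
  have hbound : ∀ p (v : E p), ‖((x p : ℂ)⁻¹ • T p) v‖ ≤ C * ‖v‖ := by
    intro p v
    rw [LinearMap.smul_apply, norm_smul, norm_inv, Complex.norm_real,
      Real.norm_of_nonneg (hx.nonneg p)]
    rcases (hx.nonneg p).eq_or_lt with h0 | h0
    -- On the boundary `(x p)⁻¹` is `0`, so the homomorphism vanishes there and the bound is
    -- trivial.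
    · rw [← h0]
      simp only [inv_zero, zero_mul]
      positivity
    · rw [inv_mul_le_iff₀ h0]
      exact (hCT p v).trans_eq (by ring)
  refine ⟨fun p => (x p : ℂ)⁻¹ • T p, hf.1, fun s => ?_, fun s hs => ?_, ⟨C, hbound⟩,
    fun t ht => ?_⟩
  · funext p
    rw [hA, hTP]
    simp only [Pi.add_apply, LinearMap.smul_apply, smul_add]
    rw [smul_comm, ← hA]
    rfl
  · refine ⟨?_, (normSq_le_mul hx.nonneg fun p => hbound p (s p)).trans_lt
      (ENNReal.mul_lt_top ENNReal.ofReal_lt_top hs.2)⟩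
    exact IsAEMeasurableSection.smul (f := fun p => (x p : ℂ)⁻¹)
      (Complex.measurable_ofReal.comp hx.contMDiff.continuous.measurable).inv
      (IsAEMeasurableSection.hom hT' hs.1)
  -- The factor `x⁻¹` is moved onto the test section, which vanishes near the boundary, so only the
  -- adjoint of the smooth `T` is needed.
  · let t₁ : smoothSections n FF F := ⟨(fun p => (x p : ℂ)⁻¹) • (t : ∀ p, F p),
      smul_mem_smoothSections_of_supportedInInterior
        (fun p hp => contMDiffAt_inv_definingFunction hx hp) t.2 ht⟩
    obtain ⟨r, hr, hr0⟩ := exists_adjoint_section hE hF T hT' t₁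
    refine ⟨r, ht.of_imp fun p hp => hr0 p ?_, fun p v => ?_⟩
    · change (x p : ℂ)⁻¹ • (t : ∀ p, F p) p = 0
      rw [hp, smul_zero]
    · rw [hr]
      change inner ℂ (T p v) ((x p : ℂ)⁻¹ • (t : ∀ p, F p) p) = _
      rw [LinearMap.smul_apply, inner_smul_left, inner_smul_right]
      simp

/-- The image of a smooth section with compact support in the interior under a wedge operator is of
class `L²`. -/
lemma isL2_wedge_apply
    {ι : Type*} {N : ι → Type u} [∀ i, TopologicalSpace (N i)]
    [∀ i, ChartedSpace (EuclideanSpace ℝ (Fin n)) (N i)]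
    {q : ι → ℕ} {Y : ι → Type*} [∀ i, TopologicalSpace (Y i)]
    [∀ i, ChartedSpace (EuclideanSpace ℝ (Fin (q i))) (Y i)]
    {emb : ∀ i, N i → M} {φ : ∀ i, N i → Y i}
    (hF : IsSmoothHermitian n FF F) (hx : IsDefiningFunction (n := n) x)
    (hmb : IsBDensity (n := n) x mb) {A : smoothSections n FE E →ₗ[ℂ] (∀ p, F p)}
    {P : smoothSections n FE E →ₗ[ℂ] smoothSections n FF F}
    (hP : IsEdgeOperator q emb φ P) (hA : EqInvMul x A P)
    {s : smoothSections n FE E} (hs : SupportedInInterior n (s : ∀ p, E p)) :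
    IsL2 FF x mb γ (A s) := by
  have hPs := hP.supportedInInterior hs
  have heq : A s = (fun p => (x p : ℂ)⁻¹) • (P s : ∀ p, F p) := funext fun p => hA s p
  rw [heq]
  refine isL2_of_supportedInInterior hF hx hmb
    (smul_mem_smoothSections_of_supportedInInterior
      (fun p hp => contMDiffAt_inv_definingFunction hx hp) (P s).2 hPs)
    (hPs.of_imp fun p hp => ?_)
  change (x p : ℂ)⁻¹ • (P s : ∀ p, F p) p = 0
  rw [hp, smul_zero]

variable {A : smoothSections n FE E →ₗ[ℂ] (∀ p, F p)}

lemma IsWeakImage.zero : IsWeakImage FF x mb γ A (0 : ∀ p, E p) (0 : ∀ p, F p) := by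
  intro t t' _ _ _
  simp [pairing]

lemma IsWeakImage.add (hE : IsSmoothHermitian n FE E) (hF : IsSmoothHermitian n FF F)
    (hx : IsDefiningFunction (n := n) x) (hmb : IsBDensity (n := n) x mb)
    {u u' : ∀ p, E p} {w w' : ∀ p, F p} (hu : IsL2 FE x mb γ u) (hu' : IsL2 FE x mb γ u')
    (hw : IsL2 FF x mb γ w) (hw' : IsL2 FF x mb γ w')
    (h : IsWeakImage FF x mb γ A u w) (h' : IsWeakImage FF x mb γ A u' w') :
    IsWeakImage FF x mb γ A (u + u') (w + w') := by
  intro t t' ht ht' htt'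
  have hxm := hx.contMDiff.continuous.measurable
  rw [pairing_add_left hF hxm hx.nonneg hw hw' (isL2_of_supportedInInterior hF hx hmb t.2 ht),
    pairing_add_left hE hxm hx.nonneg hu hu' (isL2_of_supportedInInterior hE hx hmb t'.2 ht'),
    h t t' ht ht' htt', h' t t' ht ht' htt']

/-- The Leibniz rule `A (f u) = f A u + S u` holds in the sense of distributions. -/
lemma IsWeakImage.smul (hE : IsSmoothHermitian n FE E) (hF : IsSmoothHermitian n FF F)
    (hx : IsDefiningFunction (n := n) x) (hmb : IsBDensity (n := n) x mb)
    (hAs : ∀ s : smoothSections n FE E, SupportedInInterior n (s : ∀ p, E p) →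
      IsL2 FF x mb γ (A s))
    {f : M → ℂ} {S : ∀ p, E p →ₗ[ℂ] F p} (hS : IsTameCommutator FF x mb γ A f S)
    {u : ∀ p, E p} {w : ∀ p, F p} (hu : IsL2 FE x mb γ u) (hw : IsL2 FF x mb γ w)
    (h : IsWeakImage FF x mb γ A u w) :
    IsWeakImage FF x mb γ A (f • u) (f • w + fun p => S p (u p)) := by
  intro t t' ht ht' htt'
  have hxm := hx.contMDiff.continuous.measurable
  have hfc := hS.contMDiff.continuous
  obtain ⟨r, hrs, hr⟩ := hS.adjoint t ht
  have hstar : ContMDiff (𝓡∂ (n + 1)) 𝓘(ℝ, ℂ) ∞ (star f) :=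
    Complex.conjCLE.contDiff.comp_contMDiff hS.contMDiff
  have hL2 := fun {s : smoothSections n FE E} (hs : SupportedInInterior n (s : ∀ p, E p)) =>
    isL2_of_supportedInInterior (γ := γ) hE hx hmb s.2 hs
  have htL2 : IsL2 FF x mb γ (t : ∀ p, F p) := isL2_of_supportedInInterior hF hx hmb t.2 ht
  have hsmul0 : ∀ {p} {v : E p}, v = 0 → star f p • v = 0 := by
    rintro p v rfl
    exact smul_zero _
  have hft' : SupportedInInterior n (star f • (t' : ∀ p, E p)) := ht'.of_imp fun p hp => hsmul0 hp
  have hft'L2 : IsL2 FE x mb γ (star f • (t' : ∀ p, E p)) :=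
    hL2 (s := smulSection hstar t') hft'
  -- Used twice: for test sections, to verify the formal adjoint, and for `u`, to conclude.
  have hdiff : ∀ s : ∀ p, E p, IsL2 FE x mb γ s →
      pairing x mb γ s (star f • (t' : ∀ p, E p) - (r : ∀ p, E p)) =
        pairing x mb γ (f • s) (t' : ∀ p, E p) -
          pairing x mb γ (fun p => S p (s p)) (t : ∀ p, F p) := by
    intro s hs
    rw [pairing_sub_right hE hxm hx.nonneg hs hft'L2 (hL2 hrs), pairing_smul_left, pairing_hom hr]
  have hsupp : SupportedInInterior n (star f • (t' : ∀ p, E p) - (r : ∀ p, E p)) := by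
    intro p hp
    have hsub : {p | (star f • (t' : ∀ p, E p) - (r : ∀ p, E p)) p ≠ 0} ⊆
        {p | (star f • (t' : ∀ p, E p)) p ≠ 0} ∪ {p | (r : ∀ p, E p) p ≠ 0} := by
      intro y hy
      by_contra hy'
      simp only [mem_union, mem_ofPred_eq, not_or, not_not] at hy'
      exact hy (by rw [Pi.sub_apply, hy'.1, hy'.2, sub_zero])
    have := closure_mono hsub hp
    rw [closure_union] at this
    exact this.elim (fun h => hft' h) fun h => hrs h
  -- The hypothesis on `u` is tested against `f̄ t`, whose formal adjoint image is `f̄ A⋆ t - S⋆ t`,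
  -- with `t' = A⋆ t` and `r = S⋆ t`. The last bullet checks this by applying the relation between
  -- `t` and `t'` to `f s`.
  have key := h (smulSection hstar t) (smulSection hstar t' - r)
    (ht.of_imp fun p hp => by
      change star f p • (t : ∀ p, F p) p = 0
      rw [hp, smul_zero]) hsupp ?_
  · change pairing x mb γ w (star f • (t : ∀ p, F p)) =
      pairing x mb γ u (star f • (t' : ∀ p, E p) - (r : ∀ p, E p)) at key
    rw [pairing_add_left hF hxm hx.nonneg (hw.smul hx.nonneg hfc) (hS.isL2 u hu) htL2,
      pairing_smul_left, key, hdiff u hu]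
    ring
  · intro s hs
    change pairing x mb γ (A s) (star f • (t : ∀ p, F p)) =
      pairing x mb γ (s : ∀ p, E p) (star f • (t' : ∀ p, E p) - (r : ∀ p, E p))
    have hfs : SupportedInInterior n (smulSection hS.contMDiff s : ∀ p, E p) :=
      hs.of_imp fun p hp => by
        change f p • (s : ∀ p, E p) p = 0
        rw [hp, smul_zero]
    have h1 := htt' (smulSection hS.contMDiff s) hfs
    rw [hS.apply_smul, pairing_add_left hF hxm hx.nonneg ((hAs s hs).smul hx.nonneg hfc)
      (hS.isL2 _ (hL2 hs)) htL2, pairing_smul_left] at h1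
    rw [hdiff _ (hL2 hs)]
    exact eq_sub_of_add_eq h1

end Modules

/-! ### Stability of graph-norm limits. -/

section Domains

variable {n : ℕ} {M : Type*} [TopologicalSpace M] [ChartedSpace (EuclideanHalfSpace (n + 1)) M]
  [IsManifold (𝓡∂ (n + 1)) ∞ M] [MeasurableSpace M] [BorelSpace M] [CompactSpace M]
  [SecondCountableTopology M]
  {FE : Type*} [NormedAddCommGroup FE] [NormedSpace ℂ FE] [FiniteDimensional ℂ FE]
  {E : M → Type*} [TopologicalSpace (TotalSpace FE E)] [∀ p, NormedAddCommGroup (E p)]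
  [∀ p, InnerProductSpace ℂ (E p)] [FiberBundle FE E] [VectorBundle ℂ FE E]
  [VectorBundle ℝ FE E] [ContMDiffVectorBundle ∞ FE E (𝓡∂ (n + 1))]
  {FF : Type*} [NormedAddCommGroup FF] [NormedSpace ℂ FF] [FiniteDimensional ℂ FF]
  {F : M → Type*} [TopologicalSpace (TotalSpace FF F)] [∀ p, NormedAddCommGroup (F p)]
  [∀ p, InnerProductSpace ℂ (F p)] [FiberBundle FF F] [VectorBundle ℂ FF F]
  [VectorBundle ℝ FF F] [ContMDiffVectorBundle ∞ FF F (𝓡∂ (n + 1))]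
  {x : M → ℝ} {mb : Measure M} {γ : ℝ} {A : smoothSections n FE E →ₗ[ℂ] (∀ p, F p)}

/-- The pair `(u, w)` is a limit, in the graph norm of `A`, of smooth sections with compact support
in the interior. -/
def IsGraphLimit (x : M → ℝ) (mb : Measure M) (γ : ℝ)
    (A : smoothSections n FE E →ₗ[ℂ] (∀ p, F p)) (u : ∀ p, E p) (w : ∀ p, F p) : Prop :=
  ∀ ε : ℝ≥0∞, 0 < ε → ∃ s : smoothSections n FE E, SupportedInInterior n (s : ∀ p, E p) ∧
    normSq x mb γ (w - A s) + normSq x mb γ (u - (s : ∀ p, E p)) < ε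

lemma IsGraphLimit.zero : IsGraphLimit x mb γ A (0 : ∀ p, E p) (0 : ∀ p, F p) :=
  fun ε hε => ⟨0, by simp [SupportedInInterior], by simpa [normSq] using hε⟩

lemma IsGraphLimit.add (hE : IsSmoothHermitian n FE E) (hF : IsSmoothHermitian n FF F)
    (hx : IsDefiningFunction (n := n) x) (hmb : IsBDensity (n := n) x mb)
    (hAs : ∀ s : smoothSections n FE E, SupportedInInterior n (s : ∀ p, E p) →
      IsL2 FF x mb γ (A s))
    {u u' : ∀ p, E p} {w w' : ∀ p, F p} (hu : IsL2 FE x mb γ u) (hw : IsL2 FF x mb γ w)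
    (h : IsGraphLimit x mb γ A u w) (h' : IsGraphLimit x mb γ A u' w') :
    IsGraphLimit x mb γ A (u + u') (w + w') := by
  intro ε hε
  have hxm := hx.contMDiff.continuous.measurable
  -- Each squared norm of a sum costs a factor 2, and there are two limits to add.
  have hε4 : 0 < ε / 4 := ENNReal.div_pos hε.ne' (by simp)
  obtain ⟨s, hs, hsε⟩ := h _ hε4
  obtain ⟨s', hs', hsε'⟩ := h' _ hε4
  refine ⟨s + s', ?_, ?_⟩
  · have hsub : {p | ((s + s' : smoothSections n FE E) : ∀ p, E p) p ≠ 0} ⊆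
        {p | (s : ∀ p, E p) p ≠ 0} ∪ {p | (s' : ∀ p, E p) p ≠ 0} := by
      intro y hy
      by_contra hy'
      simp only [mem_union, mem_ofPred_eq, not_or, not_not] at hy'
      exact hy (by rw [Submodule.coe_add, Pi.add_apply, hy'.1, hy'.2, add_zero])
    refine (closure_mono hsub).trans ?_
    rw [closure_union]
    exact union_subset hs hs'
  · have h1 : w + w' - A (s + s') = (w - A s) + (w' - A s') := by rw [map_add]; abel
    have h2 : u + u' - ((s + s' : smoothSections n FE E) : ∀ p, E p) =
        (u - (s : ∀ p, E p)) + (u' - (s' : ∀ p, E p)) := by rw [Submodule.coe_add]; abel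
    have hws := (hw.sub hF hxm hx.nonneg (hAs s hs)).1
    have hus := (hu.sub hE hxm hx.nonneg (isL2_of_supportedInInterior hE hx hmb s.2 hs)).1
    rw [h1, h2]
    calc _ ≤ (2 * normSq x mb γ (w - A s) + 2 * normSq x mb γ (w' - A s')) +
          (2 * normSq x mb γ (u - (s : ∀ p, E p)) + 2 * normSq x mb γ (u' - (s' : ∀ p, E p))) :=
          add_le_add (normSq_add_le hF hxm hx.nonneg hws) (normSq_add_le hE hxm hx.nonneg hus)
      _ = 2 * ((normSq x mb γ (w - A s) + normSq x mb γ (u - (s : ∀ p, E p))) +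
          (normSq x mb γ (w' - A s') + normSq x mb γ (u' - (s' : ∀ p, E p)))) := by ring
      _ < 2 * (ε / 4 + ε / 4) := by
          exact ENNReal.mul_lt_mul_right (by simp) (by simp) (ENNReal.add_lt_add hsε hsε')
      _ = ε := by
          rw [← two_mul, ← mul_assoc, show (2 : ℝ≥0∞) * 2 = 4 by norm_num]
          exact ENNReal.mul_div_cancel (by simp) (by simp)

lemma IsGraphLimit.smul (hF : IsSmoothHermitian n FF F) (hx : IsDefiningFunction (n := n) x)
    (hAs : ∀ s : smoothSections n FE E, SupportedInInterior n (s : ∀ p, E p) →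
      IsL2 FF x mb γ (A s))
    {f : M → ℂ} {S : ∀ p, E p →ₗ[ℂ] F p} (hS : IsTameCommutator FF x mb γ A f S)
    {u : ∀ p, E p} {w : ∀ p, F p} (hw : IsL2 FF x mb γ w)
    (h : IsGraphLimit x mb γ A u w) :
    IsGraphLimit x mb γ A (f • u) (f • w + fun p => S p (u p)) := by
  intro ε hε
  have hxm := hx.contMDiff.continuous.measurable
  obtain ⟨C, hC⟩ := isCompact_univ.exists_bound_of_continuousOn hS.contMDiff.continuous.continuousOn
  obtain ⟨D, hD⟩ := hS.bounded
  -- With `C` bounding `f` and `D` bounding `S`, the new squared graph error is at most `2 * K`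
  -- times the old one. The summand 1 keeps `K` nonzero, so that dividing by it is legitimate.
  set K : ℝ≥0∞ := 2 * ENNReal.ofReal (C ^ 2) + 2 * ENNReal.ofReal (D ^ 2) + 1 with hK
  have hK0 : K ≠ 0 := by simp [hK]
  have hKt : K ≠ ⊤ := by simp [hK, ENNReal.mul_eq_top]
  obtain ⟨s, hs, hsε⟩ := h (ε / (2 * K)) (ENNReal.div_pos hε.ne' (ENNReal.mul_ne_top (by simp) hKt))
  refine ⟨smulSection hS.contMDiff s, hs.of_imp fun p hp => ?_, ?_⟩
  · change f p • (s : ∀ p, E p) p = 0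
    rw [hp, smul_zero]
  -- Because the commutator has order zero, the error in the image involves only `w - A s` and `u -
  -- s`, with no derivative of `u - s`.
  have h1 : f • w + (fun p => S p (u p)) - A (smulSection hS.contMDiff s) =
      f • (w - A s) + fun p => S p ((u - (s : ∀ p, E p)) p) := by
    rw [hS.apply_smul]
    funext p
    simp only [Pi.sub_apply, Pi.add_apply, map_sub, Pi.smul_apply', smul_sub]
    abel
  have h2 : f • u - (smulSection hS.contMDiff s : ∀ p, E p) = f • (u - (s : ∀ p, E p)) :=
    (smul_sub f u (s : ∀ p, E p)).symm
  have hws := hw.sub hF hxm hx.nonneg (hAs s hs)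
  have hfw := (hws.smul hx.nonneg hS.contMDiff.continuous).1
  have e1 : normSq x mb γ (f • (w - A s)) ≤
      ENNReal.ofReal (C ^ 2) * normSq x mb γ (w - A s) :=
    normSq_le_mul hx.nonneg fun p => by
      rw [Pi.smul_apply', norm_smul]
      gcongr
      exact hC p (mem_univ p)
  have e2 : normSq x mb γ (fun p => S p ((u - (s : ∀ p, E p)) p)) ≤
      ENNReal.ofReal (D ^ 2) * normSq x mb γ (u - (s : ∀ p, E p)) :=
    normSq_le_mul hx.nonneg fun p => hD p _
  have e3 : normSq x mb γ (f • (u - (s : ∀ p, E p))) ≤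
      ENNReal.ofReal (C ^ 2) * normSq x mb γ (u - (s : ∀ p, E p)) :=
    normSq_le_mul hx.nonneg fun p => by
      rw [Pi.smul_apply', norm_smul]
      gcongr
      exact hC p (mem_univ p)
  rw [h1, h2]
  set a := normSq x mb γ (w - A s)
  set b := normSq x mb γ (u - (s : ∀ p, E p))
  calc _ ≤ (2 * (ENNReal.ofReal (C ^ 2) * a) + 2 * (ENNReal.ofReal (D ^ 2) * b)) +
        ENNReal.ofReal (C ^ 2) * b := by
        refine add_le_add ((normSq_add_le hF hxm hx.nonneg hfw).trans ?_) e3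
        gcongr
    _ ≤ 2 * K * (a + b) := by
        have i1 : ENNReal.ofReal (C ^ 2) ≤ K := by
          calc _ ≤ 2 * ENNReal.ofReal (C ^ 2) := le_mul_of_one_le_left' (by norm_num)
            _ ≤ _ := by rw [hK, add_assoc]; exact le_self_add
        have i2 : 2 * ENNReal.ofReal (C ^ 2) ≤ 2 * K := by gcongr
        have i3 : 2 * ENNReal.ofReal (D ^ 2) + ENNReal.ofReal (C ^ 2) ≤ 2 * K := by
          rw [two_mul K]
          refine add_le_add ?_ i1
          rw [hK, add_assoc, add_left_comm]
          exact le_self_add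
        calc _ = 2 * ENNReal.ofReal (C ^ 2) * a +
              (2 * ENNReal.ofReal (D ^ 2) + ENNReal.ofReal (C ^ 2)) * b := by ring
          _ ≤ 2 * K * a + 2 * K * b := by gcongr
          _ = _ := by ring
    _ < 2 * K * (ε / (2 * K)) :=
        ENNReal.mul_lt_mul_right (by simp [hK0]) (ENNReal.mul_ne_top (by simp) hKt) hsε
    _ = ε := ENNReal.mul_div_cancel (by simp [hK0]) (ENNReal.mul_ne_top (by simp) hKt)

end Domains

/-! ### The quotient of nested submodules. -/

section QuotientModule

variable {R V : Type*} [CommRing R] [AddCommGroup V] [Module R V]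

/-- The quotient of nested submodules, formed as a quotient of additive groups, is a module. -/
lemma exists_module_quotient (S T : Submodule R V) :
    ∃ _ : Module R (T.toAddSubgroup ⧸ S.toAddSubgroup.addSubgroupOf T.toAddSubgroup),
      ∀ (r : R) (u : T.toAddSubgroup),
        r • (QuotientAddGroup.mk u :
          T.toAddSubgroup ⧸ S.toAddSubgroup.addSubgroupOf T.toAddSubgroup) =
        QuotientAddGroup.mk (⟨r • (u : V), T.smul_mem r u.2⟩ : T.toAddSubgroup) :=
  -- The additive quotient agrees by definition with the quotient of `T` by the submodule pulled
  -- back from `S`.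
  ⟨inferInstanceAs (Module R (T ⧸ S.comap T.subtype)), fun _ _ => rfl⟩

end QuotientModule

end Wedge

end

/-! ### The two domains as modules. -/

theorem lemma7p1
    -- the compact connected manifold `M` with non-empty boundary
    (n : ℕ) {M : Type*} [TopologicalSpace M] [ChartedSpace (EuclideanHalfSpace (n + 1)) M]
    [IsManifold (𝓡∂ (n + 1)) ∞ M] [CompactSpace M] [T2Space M] [ConnectedSpace M]
    [MeasurableSpace M] [BorelSpace M]
    (hM : ((𝓡∂ (n + 1)).boundary M).Nonempty)
    -- the boundary fibration
    {ι : Type*} [Finite ι]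
    {N : ι → Type*} [∀ i, TopologicalSpace (N i)]
    [∀ i, ChartedSpace (EuclideanSpace ℝ (Fin n)) (N i)] [∀ i, IsManifold (𝓡 n) ∞ (N i)]
    [∀ i, CompactSpace (N i)]
    {q : ι → ℕ} {Y : ι → Type*} [∀ i, TopologicalSpace (Y i)]
    [∀ i, ChartedSpace (EuclideanSpace ℝ (Fin (q i))) (Y i)] [∀ i, IsManifold (𝓡 (q i)) ∞ (Y i)]
    [∀ i, T2Space (Y i)]
    (emb : ∀ i, N i → M) (φ : ∀ i, N i → Y i) (hφ : Wedge.IsBoundaryFibration (n := n) q emb φ)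
    -- the Hermitian vector bundles `E` and `F`
    {FE : Type*} [NormedAddCommGroup FE] [NormedSpace ℂ FE] [FiniteDimensional ℂ FE]
    {E : M → Type*} [TopologicalSpace (TotalSpace FE E)] [∀ p, NormedAddCommGroup (E p)]
    [∀ p, InnerProductSpace ℂ (E p)] [FiberBundle FE E] [VectorBundle ℂ FE E]
    [VectorBundle ℝ FE E] [ContMDiffVectorBundle ∞ FE E (𝓡∂ (n + 1))]
    (hE : Wedge.IsSmoothHermitian n FE E)
    {FF : Type*} [NormedAddCommGroup FF] [NormedSpace ℂ FF] [FiniteDimensional ℂ FF]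
    {F : M → Type*} [TopologicalSpace (TotalSpace FF F)] [∀ p, NormedAddCommGroup (F p)]
    [∀ p, InnerProductSpace ℂ (F p)] [FiberBundle FF F] [VectorBundle ℂ FF F]
    [VectorBundle ℝ FF F] [ContMDiffVectorBundle ∞ FF F (𝓡∂ (n + 1))]
    (hF : Wedge.IsSmoothHermitian n FF F)
    -- the defining function, the b-density, the weight and the operator
    (x : M → ℝ) (hx : Wedge.IsDefiningFunction (n := n) x)
    (mb : MeasureTheory.Measure M) (hmb : Wedge.IsBDensity (n := n) x mb)
    (γ : ℝ)
    (A : Wedge.smoothSections n FE E →ₗ[ℂ] (∀ p, F p))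
    (hA : Wedge.IsWedgeOperator (n := n) (FF := FF) q emb φ x A)
    (hell : Wedge.IsWElliptic (n := n) (FF := FF) q emb φ x A) :
    ∃ DMin DMax : Submodule (Wedge.ringR (n := n) emb φ) (Wedge.SectionClass E mb),
      (DMin : Set (Wedge.SectionClass E mb)) = Wedge.minDomain FF x mb γ A ∧
      (DMax : Set (Wedge.SectionClass E mb)) = Wedge.maxDomain FF x mb γ A ∧
      DMin ≤ DMax ∧
      ∃ _ : Module (Wedge.ringR (n := n) emb φ)
          (DMax.toAddSubgroup ⧸ DMin.toAddSubgroup.addSubgroupOf DMax.toAddSubgroup),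
        ∀ (f : Wedge.ringR (n := n) emb φ) (u : DMax.toAddSubgroup),
          f • (QuotientAddGroup.mk u :
              DMax.toAddSubgroup ⧸ DMin.toAddSubgroup.addSubgroupOf DMax.toAddSubgroup) =
            QuotientAddGroup.mk
              (⟨f • (u : Wedge.SectionClass E mb), DMax.smul_mem f u.2⟩ : DMax.toAddSubgroup) := by
  -- A compact manifold is second countable, which provides strong measurability of continuous
  -- functions on `M`.
  have : SecondCountableTopology (EuclideanHalfSpace (n + 1)) :=
    inferInstanceAs (SecondCountableTopology {v : EuclideanSpace ℝ (Fin (n + 1)) // 0 ≤ v 0})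
  have : SecondCountableTopology M :=
    ChartedSpace.secondCountable_of_sigmaCompact (EuclideanHalfSpace (n + 1)) M
  obtain ⟨P, hP, hAP⟩ := hA
  have hxm := hx.contMDiff.continuous.measurable
  have hAs : ∀ s : Wedge.smoothSections n FE E, Wedge.SupportedInInterior n (s : ∀ p, E p) →
      Wedge.IsL2 FF x mb γ (A s) := fun s hs => Wedge.isL2_wedge_apply hF hx hmb hP hAP hs
  have hS := fun f : Wedge.ringR (n := n) emb φ =>
    Wedge.exists_isTameCommutator (mb := mb) (γ := γ) hφ hE hF hx hP hAP f.2
  let DMax : Submodule (Wedge.ringR (n := n) emb φ) (Wedge.SectionClass E mb) :=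
    { carrier := Wedge.maxDomain FF x mb γ A
      zero_mem' := ⟨0, ⟨Wedge.IsL2.zero, 0, Wedge.IsL2.zero, Wedge.IsWeakImage.zero⟩, rfl⟩
      add_mem' := by
        rintro _ _ ⟨u, ⟨hu, w, hw, huw⟩, rfl⟩ ⟨u', ⟨hu', w', hw', huw'⟩, rfl⟩
        exact ⟨u + u', ⟨hu.add hE hxm hx.nonneg hu', w + w', hw.add hF hxm hx.nonneg hw',
          huw.add hE hF hx hmb hu hu' hw hw' huw'⟩, rfl⟩
      smul_mem' := by
        rintro f _ ⟨u, ⟨hu, w, hw, huw⟩, rfl⟩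
        obtain ⟨S, hfS⟩ := hS f
        have hfc := hfS.contMDiff.continuous
        -- The unnamed weak image of `f u` is `f w + S u`.
        exact ⟨(f : M → ℂ) • u, ⟨hu.smul hx.nonneg hfc, _,
          (hw.smul hx.nonneg hfc).add hF hxm hx.nonneg (hfS.isL2 u hu),
          huw.smul hE hF hx hmb hAs hfS hu hw⟩, rfl⟩ }
  let DMin : Submodule (Wedge.ringR (n := n) emb φ) (Wedge.SectionClass E mb) :=
    { carrier := Wedge.minDomain FF x mb γ A
      zero_mem' := ⟨0, ⟨Wedge.IsL2.zero, 0, Wedge.IsL2.zero, Wedge.IsWeakImage.zero,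
        Wedge.IsGraphLimit.zero⟩, rfl⟩
      add_mem' := by
        rintro _ _ ⟨u, ⟨hu, w, hw, huw, hlim⟩, rfl⟩ ⟨u', ⟨hu', w', hw', huw', hlim'⟩, rfl⟩
        exact ⟨u + u', ⟨hu.add hE hxm hx.nonneg hu', w + w', hw.add hF hxm hx.nonneg hw',
          huw.add hE hF hx hmb hu hu' hw hw' huw',
          Wedge.IsGraphLimit.add hE hF hx hmb hAs hu hw hlim hlim'⟩, rfl⟩
      smul_mem' := by
        rintro f _ ⟨u, ⟨hu, w, hw, huw, hlim⟩, rfl⟩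
        obtain ⟨S, hfS⟩ := hS f
        have hfc := hfS.contMDiff.continuous
        exact ⟨(f : M → ℂ) • u, ⟨hu.smul hx.nonneg hfc, _,
          (hw.smul hx.nonneg hfc).add hF hxm hx.nonneg (hfS.isL2 u hu),
          huw.smul hE hF hx hmb hAs hfS hu hw,
          Wedge.IsGraphLimit.smul hF hx hAs hfS hw hlim⟩, rfl⟩ }
  refine ⟨DMin, DMax, rfl, rfl, ?_, Wedge.exists_module_quotient DMin DMax⟩
  rintro _ ⟨u, ⟨hu, w, hw, huw, -⟩, rfl⟩
  exact ⟨u, ⟨hu, w, hw, huw⟩, rfl⟩
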